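/- **Setting.** Two users transmit to a base station with $N_r\ge 2$ receive antennas. At a fading state $\mathbf H=(\mathbf h_1,\mathbf h_2)$ user $i$ has the channel vector $\mathbf h_i=(\sqrt{h_{1i}},\dots,\sqrt{h_{N_ri}})^T$ with power gains $h_{ri}\ge 0$; the noise is Gaussian with covariance $\sigma^2\mathbf I$, $\sigma>0$. The $2N_r$ gains have a joint law that is absolutely continuous with respect to Lebesgue measure, and $E[\log(1+\|\mathbf h_i\|^2)]<\infty$ for $i=1,2$ (equivalently, average rates are finite; this holds if the gains are bounded). Let $\bar P_1,\bar P_2>0$. A feasible policy of user $i$ is a measurable function $\mathcal P_i(\mathbf H)\ge 0$ with $E[\mathcal P_i]\le\bar P_i$. In the water-filling game, user $i$ chooses a feasible policy, and its payoff is its average rate when the signal of the other user $j\neq i$ is treated as noise, $$\bar R_i(\mathcal P_1,\mathcal P_2)=E\Big[\tfrac12\log_2\det\Big(\sigma^2\mathbf I+\sum_{k=1}^2\mathcal P_k\mathbf h_k\mathbf h_k^T\Big)-\tfrac12\log_2\det\big(\sigma^2\mathbf I+\mathcal P_j\mathbf h_j\mathbf h_j^T\big)\Big].$$ A Nash equilibrium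 is a pair of feasible policies from which no user can increase its payoff by changing only its own policy to another feasible one. For a feasible pair $\mathcal P=(\mathcal P_1,\mathcal P_2)$ let $\mathcal C(\mathcal P)$ be the set of rate pairs $(R_1,R_2)$, $R_i\ge 0$, with $\sum_{i\in S}R_i\le E\big[\tfrac12\log_2\det\big(\mathbf I+\sigma^{-2}\sum_{i\in S}\mathcal P_i\mathbf h_i\mathbf h_i^T\big)\big]$ for every $S\subseteq\{1,2\}$. The capacity region is the union of the sets $\mathcal C(\mathcal P)$ over all feasible $\mathcal P$. A maximum sum-rate point ($SP$) is a point of the capacity region at which $R_1+R_2$ is maximal; a sum-rate optimal policy pair is a feasible $\mathcal P$ such that $\mathcal C(\mathcal P)$ contains such a point. **Theorem.** 1. There exists a Nash equilibrium $(\mathcal P_1^*,\mathcal P_2^*)$, and it is unique up to almost sure equality. 2. $(\mathcal P_1^*,\mathcal P_2^*)$ is a sum-rate optimal policy pair, and every sum-rate optimal policy pair equals it almost surely. 3. Every maximum sum-rate point $(R_1,R_2)$ satisfies $\bar R_i(\mathcal P_1^*,\mathcal P_2^*)\le R_i$ for $i=1,2$. Suppose in addition that there are connected open sets $U_1,U_2\subseteq\mathbb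 R^{N_r}$ such that the joint density of the gains is positive almost everywhere on $U_1\times U_2$ and zero almost everywhere outside it (for example, a density that is positive on the whole positive orthant). Then the equilibrium rates are strictly smaller than the rates at $SP$: at every maximum sum-rate point at least one of the two inequalities is strict, and there is a maximum sum-rate point at which both are strict. -/

import Mathlib

open MeasureTheory

namespace VectorMAC

noncomputable section

/-- The fading power gains: `g i r` is the gain from user `i` to receive antenna `r`. -/
abbrev Gains (Nr : ℕ) : Type := Fin 2 → Fin Nr → ℝ

/-- The fading vector of user `i`; its entries are the square roots of the power gains. -/
def fadingVec {Nr : ℕ} (g : Gains Nr) (i : Fin 2) : Fin Nr → ℝ :=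
  fun r => Real.sqrt (g i r)

/-- The total covariance of the signals of the users in `S` at fading state `g`, under the
power policies `P`: the sum over `i ∈ S` of `P i g` times the rank-one matrix
`(fadingVec g i) (fadingVec g i)ᵀ`. -/
def signalCov {Nr : ℕ} (S : Finset (Fin 2)) (P : Fin 2 → Gains Nr → ℝ) (g : Gains Nr) :
    Matrix (Fin Nr) (Fin Nr) ℝ :=
  ∑ i ∈ S, P i g • Matrix.vecMulVec (fadingVec g i) (fadingVec g i)

/-- Feasible power policies: functions of the fading state that are nonnegative and meet the
average power constraint. -/
def IsFeasible {Nr : ℕ} (μ : Measure (Gains Nr)) (Pbar : ℝ) (p : Gains Nr → ℝ) : Prop :=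
  Measurable p ∧ (∀ g, 0 ≤ p g) ∧ Integrable p μ ∧ ∫ g, p g ∂μ ≤ Pbar

/-- The payoff of user `i`: its average achievable rate (in bits) when the signal of the other
user is treated as Gaussian noise. -/
def payoff {Nr : ℕ} (μ : Measure (Gains Nr)) (σ : ℝ) (i : Fin 2)
    (P : Fin 2 → Gains Nr → ℝ) : ℝ :=
  ∫ g, ((1 / 2 : ℝ) * Real.logb 2
          (Matrix.det (σ ^ 2 • (1 : Matrix (Fin Nr) (Fin Nr) ℝ) + signalCov Finset.univ P g))
      - (1 / 2 : ℝ) * Real.logb 2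
          (Matrix.det (σ ^ 2 • (1 : Matrix (Fin Nr) (Fin Nr) ℝ) + signalCov {i}ᶜ P g))) ∂μ

/-- Nash equilibria of the water-filling game: feasible policy pairs from which no user
gains by a unilateral deviation to another feasible policy. -/
def IsNash {Nr : ℕ} (μ : Measure (Gains Nr)) (σ : ℝ) (Pbar : Fin 2 → ℝ)
    (P : Fin 2 → Gains Nr → ℝ) : Prop :=
  (∀ i, IsFeasible μ (Pbar i) (P i)) ∧
    ∀ i, ∀ q : Gains Nr → ℝ, IsFeasible μ (Pbar i) q →
      payoff μ σ i (Function.update P i q) ≤ payoff μ σ i P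

/-- The average joint rate bound of the group `S` of users under the policies `P`. -/
def groupBound {Nr : ℕ} (μ : Measure (Gains Nr)) (σ : ℝ) (S : Finset (Fin 2))
    (P : Fin 2 → Gains Nr → ℝ) : ℝ :=
  ∫ g, (1 / 2 : ℝ) * Real.logb 2
    (Matrix.det ((1 : Matrix (Fin Nr) (Fin Nr) ℝ) + (1 / σ ^ 2) • signalCov S P g)) ∂μ

/-- The pentagon of rate pairs that are achievable, with joint decoding at the base-station,
under the power policies `P`. -/
def rateRegion {Nr : ℕ} (μ : Measure (Gains Nr)) (σ : ℝ) (P : Fin 2 → Gains Nr → ℝ) :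
    Set (Fin 2 → ℝ) :=
  {R | (∀ i, 0 ≤ R i) ∧ ∀ S : Finset (Fin 2), ∑ i ∈ S, R i ≤ groupBound μ σ S P}

/-- The capacity region of the fading multiple access channel with full channel state
information: the union of the pentagons over all feasible power policies. -/
def capacityRegion {Nr : ℕ} (μ : Measure (Gains Nr)) (σ : ℝ) (Pbar : Fin 2 → ℝ) :
    Set (Fin 2 → ℝ) :=
  {R | ∃ P : Fin 2 → Gains Nr → ℝ, (∀ i, IsFeasible μ (Pbar i) (P i)) ∧ R ∈ rateRegion μ σ P}

/-- Maximum sum-rate points: the points of the capacity region at which the sum of the two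
rates is maximal. -/
def IsSumRatePoint {Nr : ℕ} (μ : Measure (Gains Nr)) (σ : ℝ) (Pbar : Fin 2 → ℝ)
    (R : Fin 2 → ℝ) : Prop :=
  R ∈ capacityRegion μ σ Pbar ∧ ∀ R' ∈ capacityRegion μ σ Pbar, ∑ i, R' i ≤ ∑ i, R i

/-- `P` is a centralized power policy pair that achieves a maximum sum-rate point. -/
def IsSumRatePolicy {Nr : ℕ} (μ : Measure (Gains Nr)) (σ : ℝ) (Pbar : Fin 2 → ℝ)
    (P : Fin 2 → Gains Nr → ℝ) : Prop :=
  (∀ i, IsFeasible μ (Pbar i) (P i)) ∧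
    ∃ R, IsSumRatePoint μ σ Pbar R ∧ R ∈ rateRegion μ σ P

/-- Up to null sets the law `μ` charges exactly a product `U 0 × U 1` of connected open sets of
gain vectors: for a law with a density, the density is positive almost everywhere on the
product and zero almost everywhere off it. -/
def HasConnectedProductSupport {Nr : ℕ} (μ : Measure (Gains Nr)) : Prop :=
  ∃ U : Fin 2 → Set (Fin Nr → ℝ), (∀ i, IsOpen (U i) ∧ IsConnected (U i)) ∧
    (volume : Measure (Gains Nr)).restrict (Set.univ.pi U) ≪ μ ∧ μ (Set.univ.pi U)ᶜ = 0

end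

end VectorMAC

open MeasureTheory

namespace VectorMAC

/-! ### The determinant polynomial of two users at one fading state -/

/-- The determinant of the received covariance, relative to the noise, as a function of the
two powers. -/
def rxDet (a b d p q : ℝ) : ℝ := 1 + a * p + b * q + d * (p * q)

theorem rxDet_swap (a b d p q : ℝ) : rxDet a b d p q = rxDet b a d q p := by
  unfold rxDet; ring

theorem one_add_sq_div_two_le_cosh (z : ℝ) : 1 + z ^ 2 / 2 ≤ Real.cosh z := by
  have h1 : Real.cosh z = 1 + 2 * Real.sinh (z / 2) ^ 2 := by
    have h := Real.cosh_two_mul (z / 2)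
    rw [mul_div_cancel₀ z two_ne_zero, Real.cosh_sq] at h
    linarith
  have h2 : (z / 2) ^ 2 ≤ Real.sinh (z / 2) ^ 2 := by
    rcases le_total 0 (z / 2) with h | h
    · exact pow_le_pow_left₀ h (Real.self_le_sinh_iff.2 h) 2
    · have := Real.sinh_le_self_iff.2 h
      nlinarith
  rw [h1]; nlinarith

theorem exp_add_exp_eq_cosh (u v : ℝ) :
    (Real.exp u + Real.exp v) / 2 = Real.exp ((u + v) / 2) * Real.cosh ((u - v) / 2) := by
  rw [Real.cosh_eq, mul_div_assoc', mul_add, ← Real.exp_add, ← Real.exp_add]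
  ring_nf

/-- Midpoint strict concavity of `log (x y - k)` in exponential coordinates. -/
theorem midpoint_exp_ineq {k u v u' v' : ℝ} (hk : 0 ≤ k) (h : k < Real.exp u * Real.exp v)
    (h' : k < Real.exp u' * Real.exp v') :
    (1 + (u - u') ^ 2 / 8) ^ 2 * ((Real.exp u * Real.exp v - k) * (Real.exp u' * Real.exp v' - k)) ≤
      ((Real.exp u + Real.exp u') / 2 * ((Real.exp v + Real.exp v') / 2) - k) ^ 2 := by
  set α := Real.exp ((u + v) / 2) with hα
  set β := Real.exp ((u' + v') / 2) with hβ
  have hαp : 0 < α := Real.exp_pos _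
  have hβp : 0 < β := Real.exp_pos _
  have e1 : Real.exp u * Real.exp v = α ^ 2 := by
    rw [hα, ← Real.exp_add, sq, ← Real.exp_add]; ring_nf
  have e2 : Real.exp u' * Real.exp v' = β ^ 2 := by
    rw [hβ, ← Real.exp_add, sq, ← Real.exp_add]; ring_nf
  set C := Real.cosh ((u - u') / 2) * Real.cosh ((v - v') / 2) with hC
  -- An arithmetic mean of exponentials is their geometric mean times a hyperbolic cosine; the
  -- cosines supply the strict gain.
  have e3 : (Real.exp u + Real.exp u') / 2 * ((Real.exp v + Real.exp v') / 2) = α * β * C := by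
    rw [exp_add_exp_eq_cosh, exp_add_exp_eq_cosh, hα, hβ, ← Real.exp_add,
      show (u + v) / 2 + (u' + v') / 2 = (u + u') / 2 + (v + v') / 2 by ring, Real.exp_add, hC]
    ring
  rw [e1] at h; rw [e2] at h'
  rw [e1, e2, e3]
  have hc : 1 + (u - u') ^ 2 / 8 ≤ C := by
    have c1 := one_add_sq_div_two_le_cosh ((u - u') / 2)
    have c2 := Real.one_le_cosh ((v - v') / 2)
    have c3 : 0 ≤ Real.cosh ((u - u') / 2) := (Real.cosh_pos _).le
    nlinarith
  set e := 1 + (u - u') ^ 2 / 8 with he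
  have he1 : 1 ≤ e := by rw [he]; nlinarith [sq_nonneg (u - u')]
  have hm : k < α * β := by
    by_contra hcon
    push Not at hcon
    have : (α * β) * (α * β) ≤ k * k := mul_le_mul hcon hcon (by positivity) hk
    have : k * k < α ^ 2 * β ^ 2 := by
      rcases hk.eq_or_lt with h0 | h0
      · rw [← h0]; simp only [mul_zero]; positivity
      · exact mul_lt_mul'' h h' hk hk
    nlinarith
  -- The difference of the two sides is `k (α - β) ^ 2`.
  have k1 : (α ^ 2 - k) * (β ^ 2 - k) ≤ (α * β - k) ^ 2 := by
    nlinarith [mul_nonneg hk (sq_nonneg (α - β))]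
  have k2 : e * (α * β - k) ≤ α * β * C - k := by
    have : α * β * e ≤ α * β * C := mul_le_mul_of_nonneg_left hc (by positivity)
    nlinarith
  calc e ^ 2 * ((α ^ 2 - k) * (β ^ 2 - k)) ≤ e ^ 2 * (α * β - k) ^ 2 :=
        mul_le_mul_of_nonneg_left k1 (sq_nonneg e)
    _ = (e * (α * β - k)) ^ 2 := by ring
    _ ≤ _ := pow_le_pow_left₀ (by have := sub_pos.2 hm; positivity) k2 2

section Pointwise

variable {a b d p q p' q' : ℝ}

theorem one_le_rxDet (ha : 0 < a) (hb : 0 < b) (hd : 0 < d) (hp : 0 ≤ p) (hq : 0 ≤ q) :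
    1 ≤ rxDet a b d p q := by
  unfold rxDet
  have : 0 ≤ a * p + b * q + d * (p * q) := by positivity
  linarith

theorem rxDet_pos (ha : 0 < a) (hb : 0 < b) (hd : 0 < d) (hp : 0 ≤ p) (hq : 0 ≤ q) :
    0 < rxDet a b d p q := lt_of_lt_of_le one_pos (one_le_rxDet ha hb hd hp hq)

/-- Completing the product, `rxDet` equals `d ((p + b/d) (q + a/d) - k)` with `k = (a b - d) / d ^ 2
≥ 0`, so `midpoint_exp_ineq` applies to the logarithms of the two factors. The explicit lower bound,
rather than mere strictness, is what later forces convergence of maximizing sequences. -/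
theorem log_rxDet_midpoint (ha : 0 < a) (hb : 0 < b) (hd : 0 < d) (hab : d ≤ a * b)
    (hp : 0 ≤ p) (hq : 0 ≤ q) (hp' : 0 ≤ p') (hq' : 0 ≤ q') :
    Real.log (1 + (Real.log (p + b / d) - Real.log (p' + b / d)) ^ 2 / 8) ≤
      Real.log (rxDet a b d ((p + p') / 2) ((q + q') / 2)) -
        (Real.log (rxDet a b d p q) + Real.log (rxDet a b d p' q')) / 2 := by
  have hs : 0 < b / d := by positivity
  have ht : 0 < a / d := by positivity
  set k := (a * b - d) / d ^ 2 with hk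
  have hk0 : 0 ≤ k := div_nonneg (by linarith) (by positivity)
  have key : ∀ x y, rxDet a b d x y = d * ((x + b / d) * (y + a / d) - k) := by
    intro x y; unfold rxDet; rw [hk]; field_simp; ring
  have D1 := rxDet_pos ha hb hd hp hq
  have D2 := rxDet_pos ha hb hd hp' hq'
  have D3 := rxDet_pos ha hb hd (show 0 ≤ (p + p') / 2 by positivity)
    (show 0 ≤ (q + q') / 2 by positivity)
  have x1 : Real.exp (Real.log (p + b / d)) = p + b / d := Real.exp_log (by positivity)
  have x2 : Real.exp (Real.log (p' + b / d)) = p' + b / d := Real.exp_log (by positivity)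
  have x3 : Real.exp (Real.log (q + a / d)) = q + a / d := Real.exp_log (by positivity)
  have x4 : Real.exp (Real.log (q' + a / d)) = q' + a / d := Real.exp_log (by positivity)
  have m := midpoint_exp_ineq (k := k) (u := Real.log (p + b / d)) (v := Real.log (q + a / d))
    (u' := Real.log (p' + b / d)) (v' := Real.log (q' + a / d)) hk0
    (by rw [x1, x3]; rw [key] at D1; nlinarith [pos_of_mul_pos_right D1 hd.le])
    (by rw [x2, x4]; rw [key] at D2; nlinarith [pos_of_mul_pos_right D2 hd.le])
  rw [x1, x2, x3, x4] at m
  set e := 1 + (Real.log (p + b / d) - Real.log (p' + b / d)) ^ 2 / 8 with he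
  have he0 : 0 < e := by positivity
  have m2 : e ^ 2 * (rxDet a b d p q * rxDet a b d p' q') ≤
      rxDet a b d ((p + p') / 2) ((q + q') / 2) ^ 2 := by
    rw [key, key, key]
    have := mul_le_mul_of_nonneg_left m (sq_nonneg d)
    calc _ = _ := by ring
      _ ≤ _ := this
      _ = _ := by ring
  have m3 := Real.log_le_log (by positivity) m2
  rw [Real.log_mul (by positivity) (by positivity), Real.log_mul D1.ne' D2.ne', Real.log_pow,
    Real.log_pow] at m3
  push_cast at m3
  linarith

theorem log_rxDet_midpoint_nonneg (ha : 0 < a) (hb : 0 < b) (hd : 0 < d) (hab : d ≤ a * b)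
    (hp : 0 ≤ p) (hq : 0 ≤ q) (hp' : 0 ≤ p') (hq' : 0 ≤ q') :
    0 ≤ Real.log (rxDet a b d ((p + p') / 2) ((q + q') / 2)) -
        (Real.log (rxDet a b d p q) + Real.log (rxDet a b d p' q')) / 2 :=
  (Real.log_nonneg (by have := sq_nonneg (Real.log (p + b / d) - Real.log (p' + b / d))
                       linarith)).trans
    (log_rxDet_midpoint ha hb hd hab hp hq hp' hq')

theorem log_rxDet_le (ha : 0 < a) (hb : 0 < b) (hd : 0 < d) (hab : d ≤ a * b)
    (hp : 0 ≤ p) (hq : 0 ≤ q) :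
    Real.log (rxDet a b d p q) ≤ Real.log (1 + a * p) + Real.log (1 + b * q) := by
  rw [← Real.log_mul (by positivity) (by positivity)]
  apply Real.log_le_log (rxDet_pos ha hb hd hp hq)
  unfold rxDet
  nlinarith [mul_le_mul_of_nonneg_right hab (mul_nonneg hp hq)]

theorem log_one_add_mul_le (ha : 0 < a) (hp : 0 ≤ p) :
    Real.log (1 + a * p) ≤ Real.log (1 + a) + Real.log (1 + p) := by
  rw [← Real.log_mul (by positivity) (by positivity)]
  exact Real.log_le_log (by positivity) (by nlinarith)

/-- This is `log z ≤ z - 1` at `z = ε (1 + p)`. The slope can be made arbitrarily small at the price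
of a constant, which expresses the sublinear growth of the rate in the power. -/
theorem log_one_add_le_mul_add {ε : ℝ} (hε : 0 < ε) (hp : 0 ≤ p) :
    Real.log (1 + p) ≤ ε * p + (ε - Real.log ε) := by
  have h := Real.log_le_sub_one_of_pos (show 0 < ε * (1 + p) by positivity)
  rw [Real.log_mul hε.ne' (by positivity)] at h
  linarith

theorem log_rxDet_le_linear (ha : 0 < a) (hb : 0 < b) (hd : 0 < d) (hab : d ≤ a * b)
    (hp : 0 ≤ p) (hq : 0 ≤ q) {ε : ℝ} (hε : 0 < ε) :
    Real.log (rxDet a b d p q) ≤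
      Real.log (1 + a) + Real.log (1 + b) + 2 * (ε - Real.log ε) + ε * (p + q) := by
  have h1 := log_rxDet_le ha hb hd hab hp hq
  have h2 := log_one_add_mul_le ha hp
  have h3 := log_one_add_mul_le hb hq
  have h4 := log_one_add_le_mul_add hε hp
  have h5 := log_one_add_le_mul_add hε hq
  linarith

/-- The partial derivative of `log (rxDet a b d p q)` in `p`. -/
noncomputable def marginal (a b d p q : ℝ) : ℝ := (a + d * q) / rxDet a b d p q

theorem marginal_pos (ha : 0 < a) (hb : 0 < b) (hd : 0 < d) (hp : 0 ≤ p) (hq : 0 ≤ q) :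
    0 < marginal a b d p q := div_pos (by positivity) (rxDet_pos ha hb hd hp hq)

theorem marginal_mul_le_one (ha : 0 < a) (hb : 0 < b) (hd : 0 < d) (hp : 0 ≤ p) (hq : 0 ≤ q) :
    marginal a b d p q * p ≤ 1 := by
  rw [marginal, div_mul_eq_mul_div, div_le_one (rxDet_pos ha hb hd hp hq)]
  unfold rxDet
  have : 0 ≤ b * q := by positivity
  linarith

theorem log_one_add_add_le {x y z : ℝ} (hx : -1 < x) (hy : -1 < y) (hz : 0 < 1 + x + y + z)
    (h : z ≤ 0 ∨ z ≤ x * y) : Real.log (1 + x + y + z) ≤ x + y := by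
  rcases h with h | h
  · have := Real.log_le_sub_one_of_pos hz
    linarith
  · have h1 := Real.log_le_sub_one_of_pos (show 0 < 1 + x by linarith)
    have h2 := Real.log_le_sub_one_of_pos (show 0 < 1 + y by linarith)
    have h3 := Real.log_le_log hz (show 1 + x + y + z ≤ (1 + x) * (1 + y) by linarith)
    rw [Real.log_mul (by linarith) (by linarith)] at h3
    linarith

/-- The tangent plane inequality of the concave function `log (rxDet a b d p q)`. -/
theorem log_rxDet_tangent (ha : 0 < a) (hb : 0 < b) (hd : 0 < d) (hab : d ≤ a * b)
    (hp : 0 ≤ p) (hq : 0 ≤ q) (hp' : 0 ≤ p') (hq' : 0 ≤ q') :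
    Real.log (rxDet a b d p' q') - Real.log (rxDet a b d p q) ≤
      marginal a b d p q * (p' - p) + marginal b a d q p * (q' - q) := by
  have D1 := rxDet_pos ha hb hd hp hq
  have D2 := rxDet_pos ha hb hd hp' hq'
  have hm1 : marginal b a d q p = (b + d * p) / rxDet a b d p q := by
    rw [marginal, rxDet_swap]
  rw [← Real.log_div D2.ne' D1.ne', hm1, marginal]
  set D := rxDet a b d p q with hD
  have eq1 : rxDet a b d p' q' / D = 1 + (a + d * q) / D * (p' - p) + (b + d * p) / D * (q' - q)
      + d * (p' - p) * (q' - q) / D := by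
    field_simp
    rw [hD]; unfold rxDet; ring
  rw [eq1]
  have hx : -1 < (a + d * q) / D * (p' - p) := by
    rw [div_mul_eq_mul_div, lt_div_iff₀ D1, hD]
    unfold rxDet
    have : 0 ≤ b * q := by positivity
    have : 0 ≤ (a + d * q) * p' := by positivity
    nlinarith
  have hy : -1 < (b + d * p) / D * (q' - q) := by
    rw [div_mul_eq_mul_div, lt_div_iff₀ D1, hD]
    unfold rxDet
    have : 0 ≤ a * p := by positivity
    have : 0 ≤ (b + d * p) * q' := by positivity
    nlinarith
  apply log_one_add_add_le hx hy (by rw [← eq1]; positivity)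
  -- If the second-order term is nonpositive, it can be dropped. Otherwise it is at most the product
  -- of the two first-order terms, and the expression is bounded by a product of two affine factors.
  rcases le_total ((p' - p) * (q' - q)) 0 with h | h
  · left
    rw [mul_assoc]
    exact div_nonpos_of_nonpos_of_nonneg (mul_nonpos_of_nonneg_of_nonpos hd.le h) D1.le
  · right
    -- The difference of the two sides is `a b - d`.
    have hκ : d * D ≤ (a + d * q) * (b + d * p) := by
      rw [hD]; unfold rxDet; nlinarith
    calc d * (p' - p) * (q' - q) / D = d * D * ((p' - p) * (q' - q)) / D ^ 2 := by
          field_simp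
      _ ≤ (a + d * q) * (b + d * p) * ((p' - p) * (q' - q)) / D ^ 2 := by
          gcongr
      _ = _ := by field_simp

/-- For fixed `q` the determinant is affine in `p`, so concavity of the logarithm suffices. It makes
difference quotients minus the chord nonnegative, as Fatou's lemma requires. -/
theorem log_rxDet_segment (ha : 0 < a) (hb : 0 < b) (hd : 0 < d)
    (hp : 0 ≤ p) (hq : 0 ≤ q) (hp' : 0 ≤ p') {t : ℝ} (ht : 0 ≤ t) (ht1 : t ≤ 1) :
    t * (Real.log (rxDet a b d p' q) - Real.log (rxDet a b d p q)) ≤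
      Real.log (rxDet a b d (p + t * (p' - p)) q) - Real.log (rxDet a b d p q) := by
  have h := strictConcaveOn_log_Ioi.concaveOn.2 (rxDet_pos ha hb hd hp hq)
    (rxDet_pos ha hb hd hp' hq) (sub_nonneg.2 ht1) ht (by ring)
  have e : (1 - t) • rxDet a b d p q + t • rxDet a b d p' q =
      rxDet a b d (p + t * (p' - p)) q := by
    simp only [smul_eq_mul]; unfold rxDet; ring
  rw [e] at h
  simp only [smul_eq_mul] at h
  linarith

theorem tendsto_log_rxDet_slope (ha : 0 < a) (hb : 0 < b) (hd : 0 < d)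
    (hp : 0 ≤ p) (hq : 0 ≤ q) :
    Filter.Tendsto (fun n : ℕ => ((n : ℝ) + 1) *
        (Real.log (rxDet a b d (p + 1 / ((n : ℝ) + 1) * (p' - p)) q) - Real.log (rxDet a b d p q)))
      Filter.atTop (nhds (marginal a b d p q * (p' - p))) := by
  have h0 : HasDerivAt (fun t : ℝ => rxDet a b d (p + t * (p' - p)) q)
      ((a + d * q) * (p' - p)) 0 := by
    have : (fun t : ℝ => rxDet a b d (p + t * (p' - p)) q) =
        fun t => rxDet a b d p q + t * ((a + d * q) * (p' - p)) := by
      funext t; unfold rxDet; ring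
    rw [this]
    simpa using ((hasDerivAt_id (0 : ℝ)).mul_const ((a + d * q) * (p' - p))).const_add
      (rxDet a b d p q)
  have h1 := h0.log (by simpa using (rxDet_pos ha hb hd hp hq).ne')
  have h2 := (hasDerivAt_iff_tendsto_slope_zero.1 h1).comp
    (f := fun n : ℕ => 1 / ((n : ℝ) + 1)) (x := Filter.atTop)
    (tendsto_nhdsWithin_iff.2 ⟨tendsto_one_div_add_atTop_nhds_zero_nat,
      Filter.Eventually.of_forall fun n => by
        simp only [Set.mem_compl_iff, Set.mem_singleton_iff]; positivity⟩)
  have e : (a + d * q) * (p' - p) / rxDet a b d (p + 0 * (p' - p)) q =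
      marginal a b d p q * (p' - p) := by
    rw [zero_mul, add_zero, marginal]; ring
  rw [e] at h2
  refine h2.congr fun n => ?_
  simp

end Pointwise

/-! ### Convergence lemmas -/

section Convergence

variable {Ω : Type*} [MeasurableSpace Ω] {μ : Measure Ω}

open Filter Topology

/-- Fatou's lemma for Bochner integrals of nonnegative functions. -/
theorem integrable_and_integral_le_of_tendsto {f : ℕ → Ω → ℝ} {f₀ : Ω → ℝ} {c : ℕ → ℝ} {C : ℝ}
    (hf : ∀ n, Integrable (f n) μ) (h0 : ∀ n, 0 ≤ᵐ[μ] f n)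
    (hlim : ∀ᵐ x ∂μ, Tendsto (fun n => f n x) atTop (𝓝 (f₀ x)))
    (hc : ∀ n, ∫ x, f n x ∂μ ≤ c n) (hC : Tendsto c atTop (𝓝 C)) :
    Integrable f₀ μ ∧ ∫ x, f₀ x ∂μ ≤ C := by
  have hm : AEStronglyMeasurable f₀ μ :=
    aestronglyMeasurable_of_tendsto_ae atTop (fun n => (hf n).aestronglyMeasurable) hlim
  have hnn : 0 ≤ᵐ[μ] f₀ := by
    filter_upwards [hlim, ae_all_iff.2 h0] with x hx hx0
    exact ge_of_tendsto' hx hx0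
  have hC0 : 0 ≤ C := ge_of_tendsto' hC fun n => (integral_nonneg_of_ae (h0 n)).trans (hc n)
  have key : ∫⁻ x, ENNReal.ofReal (f₀ x) ∂μ ≤ ENNReal.ofReal C := by
    calc ∫⁻ x, ENNReal.ofReal (f₀ x) ∂μ
        = ∫⁻ x, liminf (fun n => ENNReal.ofReal (f n x)) atTop ∂μ := by
          apply lintegral_congr_ae
          filter_upwards [hlim] with x hx
          exact ((ENNReal.tendsto_ofReal hx).liminf_eq).symm
      _ ≤ liminf (fun n => ∫⁻ x, ENNReal.ofReal (f n x) ∂μ) atTop :=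
          lintegral_liminf_le' fun n => (hf n).aestronglyMeasurable.aemeasurable.ennreal_ofReal
      _ ≤ liminf (fun n => ENNReal.ofReal (c n)) atTop := by
          refine liminf_le_liminf (Eventually.of_forall fun n => ?_)
          rw [← ofReal_integral_eq_lintegral_ofReal (hf n) (h0 n)]
          exact ENNReal.ofReal_le_ofReal (hc n)
      _ = ENNReal.ofReal C := (ENNReal.tendsto_ofReal hC).liminf_eq
  refine ⟨⟨hm, (hasFiniteIntegral_iff_ofReal hnn).2 (key.trans_lt ENNReal.ofReal_lt_top)⟩, ?_⟩
  rw [integral_eq_lintegral_of_nonneg_ae hnn hm]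
  exact ENNReal.toReal_le_of_le_ofReal hC0 key

/-- The series of the `f n` has finite integral, hence converges almost everywhere, and its terms
tend to zero. -/
theorem ae_tendsto_zero_of_integral_le_summable {f : ℕ → Ω → ℝ} {c : ℕ → ℝ}
    (hf : ∀ n, Integrable (f n) μ) (h0 : ∀ n, 0 ≤ᵐ[μ] f n) (hc : ∀ n, ∫ x, f n x ∂μ ≤ c n)
    (hs : Summable c) : ∀ᵐ x ∂μ, Tendsto (fun n => f n x) atTop (𝓝 0) := by
  have hm : ∀ n, AEMeasurable (fun x => ENNReal.ofReal (f n x)) μ :=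
    fun n => (hf n).aestronglyMeasurable.aemeasurable.ennreal_ofReal
  have hc0 : ∀ n, 0 ≤ c n := fun n => (integral_nonneg_of_ae (h0 n)).trans (hc n)
  have hfin : ∫⁻ x, ∑' n, ENNReal.ofReal (f n x) ∂μ ≠ ⊤ := by
    rw [lintegral_tsum hm]
    refine ne_top_of_le_ne_top (b := ∑' n, ENNReal.ofReal (c n)) ?_ (ENNReal.tsum_le_tsum fun n => ?_)
    · rw [← ENNReal.ofReal_tsum_of_nonneg hc0 hs]; exact ENNReal.ofReal_ne_top
    · rw [← ofReal_integral_eq_lintegral_ofReal (hf n) (h0 n)]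
      exact ENNReal.ofReal_le_ofReal (hc n)
  filter_upwards [ae_lt_top' (AEMeasurable.tsum hm) hfin, ae_all_iff.2 h0] with x hx hx0
  have h1 := ENNReal.tendsto_atTop_zero_of_tsum_ne_top hx.ne
  have h2 := (ENNReal.tendsto_toReal ENNReal.zero_ne_top).comp h1
  refine h2.congr fun n => ?_
  exact ENNReal.toReal_ofReal (hx0 n)

/-- Once `Δ n ≤ 4⁻ⁿ`, the logarithms `log (x n + s)` move by at most `4 · 2⁻ⁿ`; they form a Cauchy
sequence, and the limit is carried back by the exponential. -/
theorem exists_tendsto_of_log_increments {s : ℝ} (hs : 0 < s) {x Δ : ℕ → ℝ} (hx : ∀ n, 0 ≤ x n)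
    (h : ∀ n, Real.log (1 + (Real.log (x n + s) - Real.log (x (n + 1) + s)) ^ 2 / 8) ≤ Δ n)
    (hΔ : Tendsto (fun n => 4 ^ n * Δ n) atTop (𝓝 0)) : ∃ l, Tendsto x atTop (𝓝 l) := by
  set w : ℕ → ℝ := fun n => Real.log (x n + s) with hw
  have hΔ0 : ∀ n, 0 ≤ Δ n := fun n => (Real.log_nonneg (by
    have := sq_nonneg (w n - w (n + 1))
    linarith)).trans (h n)
  have hev : ∀ᶠ n in atTop, ‖dist (w n) (w (n + 1))‖ ≤ 4 * (1 / 2 : ℝ) ^ n := by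
    filter_upwards [hΔ.eventually (gt_mem_nhds (show (0 : ℝ) < 1 / 2 by norm_num))] with n hn
    rw [Real.norm_of_nonneg dist_nonneg, Real.dist_eq]
    apply abs_le_of_sq_le_sq _ (by positivity)
    have h4 : (1 : ℝ) ≤ 4 ^ n := one_le_pow₀ (by norm_num)
    have hΔn : Δ n ≤ 1 / 2 := by nlinarith [hΔ0 n]
    set v := (w n - w (n + 1)) ^ 2 / 8 with hv
    have hv0 : 0 ≤ v := by positivity
    have h1 := Real.one_sub_inv_le_log_of_pos (show 0 < 1 + v by positivity)
    have h2 : 1 - (1 + v)⁻¹ = v / (1 + v) := by field_simp; ring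
    have h3 : v / (1 + v) ≤ Δ n := by rw [← h2]; exact h1.trans (h n)
    rw [div_le_iff₀ (by positivity)] at h3
    have h5 : v ≤ 2 * Δ n := by nlinarith
    have h6 : (4 : ℝ) ^ n * ((1 / 2 : ℝ) ^ n) ^ 2 = 1 := by
      rw [← pow_mul, mul_comm n 2, pow_mul, ← mul_pow]; norm_num
    have h7 : 0 < ((1 / 2 : ℝ) ^ n) ^ 2 := by positivity
    have h8 : Δ n ≤ ((1 / 2 : ℝ) ^ n) ^ 2 := by
      calc Δ n = (4 ^ n * Δ n) * ((1 / 2 : ℝ) ^ n) ^ 2 := by linear_combination -(Δ n) * h6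
        _ ≤ 1 * ((1 / 2 : ℝ) ^ n) ^ 2 := by gcongr; linarith
        _ = _ := one_mul _
    have h9 : (w n - w (n + 1)) ^ 2 = 8 * v := by rw [hv]; ring
    rw [h9, mul_pow]; linarith
  have hsum : Summable fun n => dist (w n) (w (n + 1)) :=
    Summable.of_norm_bounded_eventually_nat
      ((summable_geometric_of_lt_one (by norm_num) (by norm_num)).mul_left 4) hev
  obtain ⟨l, hl⟩ := cauchySeq_tendsto_of_complete (cauchySeq_of_summable_dist hsum)
  refine ⟨Real.exp l - s, ?_⟩
  have := ((Real.continuous_exp.tendsto l).comp hl).sub_const s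
  refine this.congr fun n => ?_
  simp only [hw, Function.comp]
  rw [Real.exp_log (by have := hx n; positivity)]; ring

end Convergence

/-! ### The average sum-rate -/

section SumRate

variable {Nr : ℕ} {μ : Measure (Gains Nr)} {a b d : Gains Nr → ℝ} {A B : ℝ}
  {p q p' q' : Gains Nr → ℝ}

/-- Coefficients of the determinant polynomial of a fading two-user channel. -/
structure IsChannel (μ : Measure (Gains Nr)) (a b d : Gains Nr → ℝ) : Prop where
  measurable_left : Measurable a
  measurable_right : Measurable b
  measurable_det : Measurable d
  ae_pos : ∀ᵐ g ∂μ, 0 < a g ∧ 0 < b g ∧ 0 < d g ∧ d g ≤ a g * b g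
  integrable_left : Integrable (fun g => Real.log (1 + a g)) μ
  integrable_right : Integrable (fun g => Real.log (1 + b g)) μ

theorem IsChannel.swap (h : IsChannel μ a b d) : IsChannel μ b a d where
  measurable_left := h.measurable_right
  measurable_right := h.measurable_left
  measurable_det := h.measurable_det
  ae_pos := h.ae_pos.mono fun g hg => ⟨hg.2.1, hg.1, hg.2.2.1, by rw [mul_comm]; exact hg.2.2.2⟩
  integrable_left := h.integrable_right
  integrable_right := h.integrable_left

/-- The average of `log (rxDet a b d p q)`: up to a constant, the average sum-rate. -/
noncomputable def sumRate (μ : Measure (Gains Nr)) (a b d p q : Gains Nr → ℝ) : ℝ :=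
  ∫ g, Real.log (rxDet (a g) (b g) (d g) (p g) (q g)) ∂μ

theorem sumRate_swap : sumRate μ a b d p q = sumRate μ b a d q p := by
  unfold sumRate; simp_rw [rxDet_swap (a _)]

theorem measurable_rxDet (h : IsChannel μ a b d) (hp : Measurable p) (hq : Measurable q) :
    Measurable fun g => rxDet (a g) (b g) (d g) (p g) (q g) := by
  have := h.measurable_left; have := h.measurable_right; have := h.measurable_det
  unfold rxDet; fun_prop

theorem measurable_marginal (h : IsChannel μ a b d) (hp : Measurable p) (hq : Measurable q) :
    Measurable fun g => marginal (a g) (b g) (d g) (p g) (q g) := by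
  have := h.measurable_left; have := h.measurable_det
  have := measurable_rxDet h hp hq
  unfold marginal; fun_prop

theorem IsFeasible.segment (hp : IsFeasible μ A p) (hp' : IsFeasible μ A p') {t : ℝ}
    (ht : 0 ≤ t) (ht1 : t ≤ 1) : IsFeasible μ A fun g => p g + t * (p' g - p g) := by
  have hi : Integrable (fun g => t * (p' g - p g)) μ := (hp'.2.2.1.sub hp.2.2.1).const_mul t
  refine ⟨hp.1.add ((hp'.1.sub hp.1).const_mul t), fun g => ?_, hp.2.2.1.add hi, ?_⟩
  · have := hp.2.1 g; have := hp'.2.1 g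
    nlinarith
  · rw [integral_add hp.2.2.1 hi, integral_const_mul, integral_sub hp'.2.2.1 hp.2.2.1]
    have := hp.2.2.2; have := hp'.2.2.2
    nlinarith

theorem IsFeasible.midpoint (hp : IsFeasible μ A p) (hp' : IsFeasible μ A p') :
    IsFeasible μ A fun g => (p g + p' g) / 2 := by
  convert hp.segment hp' (t := 1 / 2) (by norm_num) (by norm_num) using 2
  ring

theorem isFeasible_zero (hA : 0 ≤ A) : IsFeasible μ A fun _ => 0 :=
  ⟨measurable_const, fun _ => le_rfl, integrable_zero _ _ _, by simpa using hA⟩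

variable [IsProbabilityMeasure μ]

theorem integrable_log_rxDet (h : IsChannel μ a b d) (hp : IsFeasible μ A p)
    (hq : IsFeasible μ B q) :
    Integrable (fun g => Real.log (rxDet (a g) (b g) (d g) (p g) (q g))) μ := by
  have hi : Integrable (fun g => Real.log (1 + a g) + Real.log (1 + b g) +
      2 * (1 - Real.log 1) + 1 * (p g + q g)) μ :=
    ((h.integrable_left.add h.integrable_right).add (integrable_const _)).add
      ((hp.2.2.1.add hq.2.2.1).const_mul 1)
  refine hi.mono' (measurable_rxDet h hp.1 hq.1).log.aestronglyMeasurable ?_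
  filter_upwards [h.ae_pos] with g ⟨ha, hb, hd, hab⟩
  rw [Real.norm_of_nonneg (Real.log_nonneg (one_le_rxDet ha hb hd (hp.2.1 g) (hq.2.1 g)))]
  exact log_rxDet_le_linear ha hb hd hab (hp.2.1 g) (hq.2.1 g) one_pos

theorem sumRate_le_linear (h : IsChannel μ a b d) (hp : IsFeasible μ A p)
    (hq : IsFeasible μ B q) {ε : ℝ} (hε : 0 < ε) :
    sumRate μ a b d p q ≤ (∫ g, (Real.log (1 + a g) + Real.log (1 + b g)) ∂μ) +
      2 * (ε - Real.log ε) + ε * (A + B) := by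
  have hk := h.integrable_left.fun_add h.integrable_right
  have hk2 : Integrable (fun g => Real.log (1 + a g) + Real.log (1 + b g) +
    2 * (ε - Real.log ε)) μ := hk.add (integrable_const _)
  have hpq : Integrable (fun g => ε * (p g + q g)) μ := (hp.2.2.1.add hq.2.2.1).const_mul ε
  have h1 : sumRate μ a b d p q ≤ ∫ g, (Real.log (1 + a g) + Real.log (1 + b g) +
      2 * (ε - Real.log ε) + ε * (p g + q g)) ∂μ := by
    apply integral_mono_ae (integrable_log_rxDet h hp hq) (hk2.add hpq)
    filter_upwards [h.ae_pos] with g ⟨ha, hb, hd, hab⟩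
    exact log_rxDet_le_linear ha hb hd hab (hp.2.1 g) (hq.2.1 g) hε
  rw [integral_add hk2 hpq, integral_add hk (integrable_const _), integral_const_mul ε,
    integral_add hp.2.2.1 hq.2.2.1] at h1
  simp only [integral_const, probReal_univ, smul_eq_mul, one_mul] at h1
  have := mul_le_mul_of_nonneg_left (add_le_add hp.2.2.2 hq.2.2.2) hε.le
  linarith

/-! ### Midpoint concavity and uniqueness of the optimal pair -/

/-- The gap in the midpoint concavity of the sum-rate at one fading state. -/
noncomputable def midGap (a b d p q p' q' : ℝ) : ℝ :=
  Real.log (rxDet a b d ((p + p') / 2) ((q + q') / 2)) -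
    (Real.log (rxDet a b d p q) + Real.log (rxDet a b d p' q')) / 2

theorem integrable_midGap (h : IsChannel μ a b d) (hp : IsFeasible μ A p)
    (hq : IsFeasible μ B q) (hp' : IsFeasible μ A p') (hq' : IsFeasible μ B q') :
    Integrable (fun g => midGap (a g) (b g) (d g) (p g) (q g) (p' g) (q' g)) μ :=
  (integrable_log_rxDet h (hp.midpoint hp') (hq.midpoint hq')).sub
    (((integrable_log_rxDet h hp hq).add (integrable_log_rxDet h hp' hq')).div_const 2)

theorem integral_midGap (h : IsChannel μ a b d) (hp : IsFeasible μ A p)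
    (hq : IsFeasible μ B q) (hp' : IsFeasible μ A p') (hq' : IsFeasible μ B q') :
    ∫ g, midGap (a g) (b g) (d g) (p g) (q g) (p' g) (q' g) ∂μ =
      sumRate μ a b d (fun g => (p g + p' g) / 2) (fun g => (q g + q' g) / 2) -
        (sumRate μ a b d p q + sumRate μ a b d p' q') / 2 := by
  have h1 := integrable_log_rxDet h hp hq
  have h2 := integrable_log_rxDet h hp' hq'
  have h3 := integrable_log_rxDet h (hp.midpoint hp') (hq.midpoint hq')
  unfold midGap sumRate
  rw [integral_sub h3 ((h1.fun_add h2).div_const 2), integral_div, integral_add h1 h2]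

omit [IsProbabilityMeasure μ] in
theorem midGap_nonneg_ae (h : IsChannel μ a b d) (hp : IsFeasible μ A p)
    (hq : IsFeasible μ B q) (hp' : IsFeasible μ A p') (hq' : IsFeasible μ B q') :
    0 ≤ᵐ[μ] fun g => midGap (a g) (b g) (d g) (p g) (q g) (p' g) (q' g) := by
  filter_upwards [h.ae_pos] with g ⟨ha, hb, hd, hab⟩
  exact log_rxDet_midpoint_nonneg ha hb hd hab (hp.2.1 g) (hq.2.1 g) (hp'.2.1 g) (hq'.2.1 g)

theorem midGap_swap (a b d p q p' q' : ℝ) :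
    midGap a b d p q p' q' = midGap b a d q p q' p' := by
  unfold midGap; simp only [rxDet_swap a]

/-- A feasible pair of policies of maximal average sum-rate. -/
def IsMaxPair (μ : Measure (Gains Nr)) (a b d : Gains Nr → ℝ) (A B : ℝ)
    (p q : Gains Nr → ℝ) : Prop :=
  IsFeasible μ A p ∧ IsFeasible μ B q ∧ ∀ p' q', IsFeasible μ A p' → IsFeasible μ B q' →
    sumRate μ a b d p' q' ≤ sumRate μ a b d p q

omit [IsProbabilityMeasure μ] in
theorem IsMaxPair.swap (h : IsMaxPair μ a b d A B p q) : IsMaxPair μ b a d B A q p := by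
  refine ⟨h.2.1, h.1, fun q' p' hq' hp' => ?_⟩
  rw [sumRate_swap, sumRate_swap (a := b)]
  exact h.2.2 p' q' hp' hq'

/-- The midpoint of two optimal pairs is feasible, so the nonnegative concavity gap has integral
zero and vanishes almost everywhere. The quantitative bound then forces `log (p + b/d) = log (p' +
b/d)`. -/
theorem IsMaxPair.ae_eq_left (h : IsChannel μ a b d) (hm : IsMaxPair μ a b d A B p q)
    (hm' : IsMaxPair μ a b d A B p' q') : p =ᵐ[μ] p' := by
  obtain ⟨hp, hq, hmax⟩ := hm
  obtain ⟨hp', hq', hmax'⟩ := hm'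
  have h0 : ∫ g, midGap (a g) (b g) (d g) (p g) (q g) (p' g) (q' g) ∂μ = 0 := by
    apply le_antisymm _ (integral_nonneg_of_ae (midGap_nonneg_ae h hp hq hp' hq'))
    rw [integral_midGap h hp hq hp' hq']
    have := hmax _ _ (hp.midpoint hp') (hq.midpoint hq')
    have := hmax' _ _ (hp.midpoint hp') (hq.midpoint hq')
    linarith
  rw [integral_eq_zero_iff_of_nonneg_ae (midGap_nonneg_ae h hp hq hp' hq')
    (integrable_midGap h hp hq hp' hq')] at h0
  filter_upwards [h0, h.ae_pos] with g hg ⟨ha, hb, hd, hab⟩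
  have h1 := log_rxDet_midpoint ha hb hd hab (hp.2.1 g) (hq.2.1 g) (hp'.2.1 g) (hq'.2.1 g)
  change _ ≤ midGap _ _ _ _ _ _ _ at h1
  rw [hg] at h1
  set z := Real.log (p g + b g / d g) - Real.log (p' g + b g / d g) with hz
  have hz2 : z ^ 2 = 0 := by
    have h2 : 1 + z ^ 2 / 8 ≤ 1 := by
      have := (Real.log_nonpos_iff (show 0 ≤ 1 + z ^ 2 / 8 by positivity)).1 h1
      exact this
    nlinarith [sq_nonneg z]
  have hz0 : z = 0 := by simpa using hz2
  have hs : 0 < b g / d g := by positivity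
  have := Real.log_injOn_pos (Set.mem_Ioi.2 (by have := hp.2.1 g; positivity))
    (Set.mem_Ioi.2 (by have := hp'.2.1 g; positivity)) (sub_eq_zero.1 hz0)
  linarith

theorem IsMaxPair.ae_eq_right (h : IsChannel μ a b d) (hm : IsMaxPair μ a b d A B p q)
    (hm' : IsMaxPair μ a b d A B p' q') : q =ᵐ[μ] q' :=
  hm.swap.ae_eq_left h.swap hm'.swap

/-! ### Existence of an optimal pair -/

omit [IsProbabilityMeasure μ] in
open Filter Topology in
-- Fatou's lemma preserves the power constraint. The limit is truncated at zero because feasibility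
-- asks for nonnegativity at every state, not only almost everywhere.
theorem exists_policy_limit {p : ℕ → Gains Nr → ℝ} (hp : ∀ n, IsFeasible μ A (p n))
    (hlim : ∀ᵐ g ∂μ, ∃ l, Tendsto (fun n => p n g) atTop (𝓝 l)) :
    ∃ p₀, IsFeasible μ A p₀ ∧ ∀ᵐ g ∂μ, Tendsto (fun n => p n g) atTop (𝓝 (p₀ g)) := by
  obtain ⟨f, hf, hft⟩ := measurable_limit_of_tendsto_metrizable_ae
    (fun n => (hp n).1.aemeasurable) hlim
  have ht : ∀ᵐ g ∂μ, Tendsto (fun n => p n g) atTop (𝓝 (max (f g) 0)) := by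
    filter_upwards [hft] with g hg
    rwa [max_eq_left (ge_of_tendsto' hg fun n => (hp n).2.1 g)]
  obtain ⟨h1, h2⟩ := integrable_and_integral_le_of_tendsto (fun n => (hp n).2.2.1)
    (fun n => Eventually.of_forall (hp n).2.1) ht (fun n => (hp n).2.2.2) tendsto_const_nhds
  exact ⟨_, ⟨hf.max measurable_const, fun g => le_max_right _ _, h1, h2⟩, ht⟩

open Filter Topology in
-- Upper semicontinuity of the sum-rate. The powers need not be dominated, so Fatou's lemma is
-- applied to the linear majorant of slope `ε` minus the rate; the error is at most `ε (A + B)`, and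
-- `ε` is arbitrary.
theorem le_sumRate_of_tendsto (h : IsChannel μ a b d) (hA : 0 < A) (hB : 0 < B)
    {p q : ℕ → Gains Nr → ℝ} {p₀ q₀ : Gains Nr → ℝ} {c : ℕ → ℝ} {C : ℝ}
    (hp : ∀ n, IsFeasible μ A (p n)) (hq : ∀ n, IsFeasible μ B (q n))
    (hp₀ : IsFeasible μ A p₀) (hq₀ : IsFeasible μ B q₀)
    (hpt : ∀ᵐ g ∂μ, Tendsto (fun n => p n g) atTop (𝓝 (p₀ g)))
    (hqt : ∀ᵐ g ∂μ, Tendsto (fun n => q n g) atTop (𝓝 (q₀ g)))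
    (hc : ∀ n, c n ≤ sumRate μ a b d (p n) (q n)) (hC : Tendsto c atTop (𝓝 C)) :
    C ≤ sumRate μ a b d p₀ q₀ := by
  apply le_of_forall_pos_le_add
  intro δ hδ
  set ε := δ / (A + B) with hε
  have hε0 : 0 < ε := by positivity
  have hεδ : ε * (A + B) = δ := by rw [hε]; field_simp
  have hk : Integrable (fun g => Real.log (1 + a g) + Real.log (1 + b g) +
    2 * (ε - Real.log ε)) μ := (h.integrable_left.add h.integrable_right).add (integrable_const _)
  set K := ∫ g, (Real.log (1 + a g) + Real.log (1 + b g) + 2 * (ε - Real.log ε)) ∂μ with hK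
  have hpq : ∀ {x y : Gains Nr → ℝ}, IsFeasible μ A x → IsFeasible μ B y →
      Integrable (fun g => ε * (x g + y g)) μ :=
    fun hx hy => (hx.2.2.1.add hy.2.2.1).const_mul ε
  have hval : ∀ {x y : Gains Nr → ℝ}, IsFeasible μ A x → IsFeasible μ B y →
      ∫ g, (Real.log (1 + a g) + Real.log (1 + b g) + 2 * (ε - Real.log ε) + ε * (x g + y g) -
        Real.log (rxDet (a g) (b g) (d g) (x g) (y g))) ∂μ =
      K + ε * (∫ g, x g ∂μ + ∫ g, y g ∂μ) - sumRate μ a b d x y := by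
    intro x y hx hy
    rw [integral_sub (hk.fun_add (hpq hx hy)) (integrable_log_rxDet h hx hy),
      integral_add hk (hpq hx hy), integral_const_mul, integral_add hx.2.2.1 hy.2.2.1, sumRate]
  have key := (integrable_and_integral_le_of_tendsto
    (f := fun n g => Real.log (1 + a g) + Real.log (1 + b g) + 2 * (ε - Real.log ε) +
      ε * (p n g + q n g) - Real.log (rxDet (a g) (b g) (d g) (p n g) (q n g)))
    (f₀ := fun g => Real.log (1 + a g) + Real.log (1 + b g) + 2 * (ε - Real.log ε) +
      ε * (p₀ g + q₀ g) - Real.log (rxDet (a g) (b g) (d g) (p₀ g) (q₀ g)))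
    (c := fun n => K + ε * (A + B) - c n) (C := K + ε * (A + B) - C)
    (fun n => (hk.add (hpq (hp n) (hq n))).sub (integrable_log_rxDet h (hp n) (hq n)))
    (fun n => ?_) ?_ (fun n => ?_) (tendsto_const_nhds.sub hC)).2
  · rw [hval hp₀ hq₀] at key
    have h1 : 0 ≤ ∫ g, p₀ g ∂μ := integral_nonneg hp₀.2.1
    have h2 : 0 ≤ ∫ g, q₀ g ∂μ := integral_nonneg hq₀.2.1
    have := mul_nonneg hε0.le (add_nonneg h1 h2)
    linarith
  · filter_upwards [h.ae_pos] with g ⟨ha, hb, hd, hab⟩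
    exact sub_nonneg.2 (log_rxDet_le_linear ha hb hd hab ((hp n).2.1 g) ((hq n).2.1 g) hε0)
  · filter_upwards [h.ae_pos, hpt, hqt] with g ⟨ha, hb, hd, hab⟩ h1 h2
    refine (((h1.add h2).const_mul ε).const_add _).sub (Tendsto.log ?_
      (rxDet_pos ha hb hd (hp₀.2.1 g) (hq₀.2.1 g)).ne')
    unfold rxDet
    exact (((h1.const_mul _).const_add 1).add (h2.const_mul _)).add ((h1.mul h2).const_mul _)
  · rw [hval (hp n) (hq n)]
    have h1 := mul_le_mul_of_nonneg_left (add_le_add (hp n).2.2.2 (hq n).2.2.2) hε0.le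
    have h2 := hc n
    linarith

open Filter Topology in
theorem exists_isMaxPair (h : IsChannel μ a b d) (hA : 0 < A) (hB : 0 < B) :
    ∃ p q, IsMaxPair μ a b d A B p q := by
  set S : Set ℝ := {x | ∃ p q, IsFeasible μ A p ∧ IsFeasible μ B q ∧ sumRate μ a b d p q = x}
  have hS : S.Nonempty := ⟨_, _, _, isFeasible_zero hA.le, isFeasible_zero hB.le, rfl⟩
  have hbdd : BddAbove S := by
    refine ⟨(∫ g, (Real.log (1 + a g) + Real.log (1 + b g)) ∂μ) +
      2 * (1 - Real.log 1) + 1 * (A + B), ?_⟩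
    rintro _ ⟨p, q, hp, hq, rfl⟩
    exact sumRate_le_linear h hp hq one_pos
  have hle : ∀ {p q}, IsFeasible μ A p → IsFeasible μ B q → sumRate μ a b d p q ≤ sSup S :=
    fun hp hq => le_csSup hbdd ⟨_, _, hp, hq, rfl⟩
  -- With deficits `16⁻ⁿ` the mean concavity gap of consecutive pairs is at most `16⁻ⁿ`. Even after
  -- multiplication by `4ⁿ` these means are summable, so the gaps are almost surely `o(4⁻ⁿ)`.
  have hseq : ∀ n : ℕ, ∃ p q, IsFeasible μ A p ∧ IsFeasible μ B q ∧
      sSup S - (1 / 16 : ℝ) ^ n ≤ sumRate μ a b d p q := by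
    intro n
    obtain ⟨_, ⟨p, q, hp, hq, rfl⟩, hlt⟩ := exists_lt_of_lt_csSup hS
      (show sSup S - (1 / 16 : ℝ) ^ n < sSup S by
        have : (0 : ℝ) < (1 / 16 : ℝ) ^ n := by positivity
        linarith)
    exact ⟨p, q, hp, hq, hlt.le⟩
  choose p q hp hq hpq using hseq
  set Δ : ℕ → Gains Nr → ℝ := fun n g =>
    midGap (a g) (b g) (d g) (p n g) (q n g) (p (n + 1) g) (q (n + 1) g) with hΔ
  have hΔi : ∀ n, Integrable (Δ n) μ := fun n => integrable_midGap h (hp _) (hq _) (hp _) (hq _)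
  have hΔn : ∀ n, 0 ≤ᵐ[μ] Δ n := fun n => midGap_nonneg_ae h (hp _) (hq _) (hp _) (hq _)
  have hΔe : ∀ n, ∫ g, 4 ^ n * Δ n g ∂μ ≤ (1 / 4 : ℝ) ^ n := by
    intro n
    have h1 : ∫ g, Δ n g ∂μ ≤ (1 / 16 : ℝ) ^ n := by
      rw [integral_midGap h (hp _) (hq _) (hp _) (hq _)]
      have h2 := hle ((hp n).midpoint (hp (n + 1))) ((hq n).midpoint (hq (n + 1)))
      have h3 := hpq n
      have h4 := hpq (n + 1)
      have h5 : (0 : ℝ) < (1 / 16 : ℝ) ^ n := by positivity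
      rw [pow_succ] at h4
      linarith
    rw [integral_const_mul]
    calc (4 : ℝ) ^ n * ∫ g, Δ n g ∂μ ≤ 4 ^ n * (1 / 16 : ℝ) ^ n := by gcongr
      _ = (1 / 4 : ℝ) ^ n := by rw [← mul_pow]; norm_num
  have hΔ0 := ae_tendsto_zero_of_integral_le_summable (fun n => (hΔi n).const_mul (4 ^ n))
    (fun n => (hΔn n).mono fun g hg => mul_nonneg (by positivity) hg) hΔe
    (summable_geometric_of_lt_one (by norm_num) (by norm_num))
  obtain ⟨p₀, hp₀, hpt⟩ := exists_policy_limit hp (by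
    filter_upwards [hΔ0, h.ae_pos] with g hg ⟨ha, hb, hd, hab⟩
    exact exists_tendsto_of_log_increments (div_pos hb hd) (fun n => (hp n).2.1 g)
      (fun n => log_rxDet_midpoint ha hb hd hab ((hp _).2.1 g) ((hq _).2.1 g) ((hp _).2.1 g)
        ((hq _).2.1 g)) hg)
  obtain ⟨q₀, hq₀, hqt⟩ := exists_policy_limit hq (by
    filter_upwards [hΔ0, h.swap.ae_pos] with g hg ⟨ha, hb, hd, hab⟩
    exact exists_tendsto_of_log_increments (div_pos hb hd) (fun n => (hq n).2.1 g)
      (fun n => (log_rxDet_midpoint ha hb hd hab ((hq _).2.1 g) ((hp _).2.1 g) ((hq _).2.1 g)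
        ((hp _).2.1 g)).trans_eq (midGap_swap _ _ _ _ _ _ _)) hg)
  have hlim : Tendsto (fun n : ℕ => sSup S - (1 / 16 : ℝ) ^ n) atTop (𝓝 (sSup S)) := by
    simpa using tendsto_const_nhds.sub
      (tendsto_pow_atTop_nhds_zero_of_lt_one (r := (1 / 16 : ℝ)) (by norm_num) (by norm_num))
  exact ⟨p₀, q₀, hp₀, hq₀, fun p' q' hp' hq' => (hle hp' hq').trans
    (le_sumRate_of_tendsto h hA hB hp hq hp₀ hq₀ hpt hqt hpq hlim)⟩

/-! ### First-order conditions and Kuhn-Tucker multipliers -/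

/-- The variational inequality at a policy that is optimal against a fixed one. -/
theorem integral_marginal_mul_sub_nonpos (h : IsChannel μ a b d) (hp : IsFeasible μ A p)
    (hq : IsFeasible μ B q)
    (hmax : ∀ p', IsFeasible μ A p' → sumRate μ a b d p' q ≤ sumRate μ a b d p q)
    (hp' : IsFeasible μ A p') :
    Integrable (fun g => marginal (a g) (b g) (d g) (p g) (q g) * (p' g - p g)) μ ∧
      ∫ g, marginal (a g) (b g) (d g) (p g) (q g) * (p' g - p g) ∂μ ≤ 0 := by
  have hi := integrable_log_rxDet h hp hq
  have hi' := integrable_log_rxDet h hp' hq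
  have hdi : Integrable (fun g => Real.log (rxDet (a g) (b g) (d g) (p' g) (q g)) -
    Real.log (rxDet (a g) (b g) (d g) (p g) (q g))) μ := hi'.sub hi
  have ht : ∀ n : ℕ, 0 ≤ 1 / ((n : ℝ) + 1) ∧ 1 / ((n : ℝ) + 1) ≤ 1 := fun n =>
    ⟨by positivity, by rw [div_le_one (by positivity)]; linarith [n.cast_nonneg (α := ℝ)]⟩
  have hseg : ∀ n : ℕ, IsFeasible μ A fun g => p g + 1 / ((n : ℝ) + 1) * (p' g - p g) :=
    fun n => hp.segment hp' (ht n).1 (ht n).2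
  have hin := fun n => integrable_log_rxDet h (hseg n) hq
  have hslope : ∀ n : ℕ, Integrable (fun g => ((n : ℝ) + 1) *
      (Real.log (rxDet (a g) (b g) (d g) (p g + 1 / ((n : ℝ) + 1) * (p' g - p g)) (q g)) -
        Real.log (rxDet (a g) (b g) (d g) (p g) (q g)))) μ :=
    fun n => ((hin n).sub hi).const_mul _
  -- Difference quotients along the segment to `p'`, minus the full chord, are nonnegative by
  -- concavity and converge to the directional derivative minus the chord. Optimality makes the
  -- integrals of the quotients nonpositive. Fatou's lemma then gives the integrability of the
  -- derivative as well as its sign.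
  have key := integrable_and_integral_le_of_tendsto
    (f := fun (n : ℕ) g => ((n : ℝ) + 1) *
        (Real.log (rxDet (a g) (b g) (d g) (p g + 1 / ((n : ℝ) + 1) * (p' g - p g)) (q g)) -
          Real.log (rxDet (a g) (b g) (d g) (p g) (q g))) -
        (Real.log (rxDet (a g) (b g) (d g) (p' g) (q g)) -
          Real.log (rxDet (a g) (b g) (d g) (p g) (q g))))
    (f₀ := fun g => marginal (a g) (b g) (d g) (p g) (q g) * (p' g - p g) -
        (Real.log (rxDet (a g) (b g) (d g) (p' g) (q g)) -
          Real.log (rxDet (a g) (b g) (d g) (p g) (q g))))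
    (c := fun _ => -(sumRate μ a b d p' q - sumRate μ a b d p q))
    (fun n => (hslope n).sub hdi) (fun n => ?_) ?_ (fun n => ?_)
    tendsto_const_nhds
  · have hint := key.1.add hdi
    have e : ((fun g => marginal (a g) (b g) (d g) (p g) (q g) * (p' g - p g) -
        (Real.log (rxDet (a g) (b g) (d g) (p' g) (q g)) -
          Real.log (rxDet (a g) (b g) (d g) (p g) (q g)))) +
        fun g => (Real.log (rxDet (a g) (b g) (d g) (p' g) (q g)) -
          Real.log (rxDet (a g) (b g) (d g) (p g) (q g)))) =
        fun g => marginal (a g) (b g) (d g) (p g) (q g) * (p' g - p g) := by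
      funext g; simp
    have hint2 : Integrable (fun g => marginal (a g) (b g) (d g) (p g) (q g) * (p' g - p g)) μ := by
      rw [← e]; exact hint
    refine ⟨hint2, ?_⟩
    have h2 := key.2
    rw [integral_sub hint2 hdi, integral_sub hi' hi] at h2
    unfold sumRate at h2
    linarith
  · filter_upwards [h.ae_pos] with g ⟨ha, hb, hd, hab⟩
    have h1 := log_rxDet_segment ha hb hd (hp.2.1 g) (hq.2.1 g) (hp'.2.1 g) (ht n).1 (ht n).2
    have hn : (0 : ℝ) < (n : ℝ) + 1 := by positivity
    rw [one_div, inv_mul_le_iff₀ hn, ← one_div] at h1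
    exact sub_nonneg.2 h1
  · filter_upwards [h.ae_pos] with g ⟨ha, hb, hd, hab⟩
    exact (tendsto_log_rxDet_slope ha hb hd (hp.2.1 g) (hq.2.1 g)).sub_const _
  · rw [integral_sub (hslope n) hdi, integral_const_mul,
      integral_sub (hin n) hi, integral_sub hi' hi]
    have h1 := hmax _ (hseg n)
    have hn : (0 : ℝ) ≤ (n : ℝ) + 1 := by positivity
    unfold sumRate at h1 ⊢
    have := mul_nonneg hn (sub_nonneg.2 h1)
    linarith

/-- A pair of policies, each optimal against the other one, is optimal. -/
theorem isMaxPair_of_coordinatewise (h : IsChannel μ a b d) (hp : IsFeasible μ A p)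
    (hq : IsFeasible μ B q)
    (hmax : ∀ p', IsFeasible μ A p' → sumRate μ a b d p' q ≤ sumRate μ a b d p q)
    (hmax' : ∀ q', IsFeasible μ B q' → sumRate μ a b d p q' ≤ sumRate μ a b d p q) :
    IsMaxPair μ a b d A B p q := by
  refine ⟨hp, hq, fun p' q' hp' hq' => ?_⟩
  obtain ⟨h1, h2⟩ := integral_marginal_mul_sub_nonpos h hp hq hmax hp'
  obtain ⟨h3, h4⟩ := integral_marginal_mul_sub_nonpos h.swap hq hp
    (fun q' hq' => by rw [sumRate_swap, sumRate_swap (a := b)]; exact hmax' q' hq') hq'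
  -- The tangent plane bounds the joint change by a sum of two one-user terms, each with nonpositive
  -- integral.
  have h5 := integral_mono_ae ((integrable_log_rxDet h hp' hq').sub (integrable_log_rxDet h hp hq))
    (h1.add h3) (by
      filter_upwards [h.ae_pos] with g ⟨ha, hb, hd, hab⟩
      exact log_rxDet_tangent ha hb hd hab (hp.2.1 g) (hq.2.1 g) (hp'.2.1 g) (hq'.2.1 g))
  simp only [Pi.sub_apply, Pi.add_apply] at h5
  rw [integral_sub (integrable_log_rxDet h hp' hq') (integrable_log_rxDet h hp hq),
    integral_add h1 h3] at h5
  unfold sumRate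
  linarith

/-- The Kuhn-Tucker conditions of the first user at an optimal pair. -/
theorem IsMaxPair.kuhnTucker (h : IsChannel μ a b d) (hA : 0 < A)
    (hm : IsMaxPair μ a b d A B p q) :
    ∃ lam : ℝ, 0 < lam ∧
      (∀ᵐ g ∂μ, marginal (a g) (b g) (d g) (p g) (q g) ≤ lam ∧
        (0 < p g → marginal (a g) (b g) (d g) (p g) (q g) = lam)) ∧
      ¬ ∀ᵐ g ∂μ, p g = 0 := by
  obtain ⟨hp, hq, hmax⟩ := hm
  set G : Gains Nr → ℝ := fun g => marginal (a g) (b g) (d g) (p g) (q g) with hG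
  have hGm : Measurable G := measurable_marginal h hp.1 hq.1
  have hGpos : ∀ᵐ g ∂μ, 0 < G g := by
    filter_upwards [h.ae_pos] with g ⟨ha, hb, hd, hab⟩
    exact marginal_pos ha hb hd (hp.2.1 g) (hq.2.1 g)
  have hGp : Integrable (fun g => G g * p g) μ := by
    refine (integrable_const (1 : ℝ)).mono' (hGm.mul hp.1).aestronglyMeasurable ?_
    filter_upwards [h.ae_pos] with g ⟨ha, hb, hd, hab⟩
    rw [Real.norm_of_nonneg (mul_nonneg (marginal_pos ha hb hd (hp.2.1 g) (hq.2.1 g)).le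
      (hp.2.1 g))]
    exact marginal_mul_le_one ha hb hd (hp.2.1 g) (hq.2.1 g)
  have hvar : ∀ {p'}, IsFeasible μ A p' → Integrable (fun g => G g * p' g) μ ∧
      ∫ g, G g * p' g ∂μ ≤ ∫ g, G g * p g ∂μ := by
    intro p' hp'
    obtain ⟨h1, h2⟩ := integral_marginal_mul_sub_nonpos h hp hq (fun p' hp' => hmax p' q hp' hq) hp'
    have h3 : Integrable (fun g => G g * p' g) μ := by
      refine (h1.add hGp).congr (Filter.Eventually.of_forall fun g => ?_)
      simp only [Pi.add_apply, hG]; ring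
    refine ⟨h3, ?_⟩
    have h4 : ∫ g, (G g * p' g - G g * p g) ∂μ ≤ 0 := by
      refine le_of_eq_of_le (integral_congr_ae (Filter.Eventually.of_forall fun g => ?_)) h2
      simp only [hG]; ring
    rw [integral_sub h3 hGp] at h4
    linarith
  -- By the variational inequality `p` maximizes the linear functional `∫ G p'` over the budget `A`;
  -- the multiplier is the optimal value per unit of power.
  set lam := (∫ g, G g * p g ∂μ) / A with hlam
  have hlamA : ∫ g, G g * p g ∂μ = lam * A := by rw [hlam]; field_simp
  have hlam0 : 0 ≤ lam := div_nonneg (integral_nonneg_of_ae (by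
    filter_upwards [hGpos] with g hg
    exact mul_nonneg hg.le (hp.2.1 g))) hA.le
  have hle : ∀ᵐ g ∂μ, G g ≤ lam := by
    by_contra hcon
    set T := {g | lam < G g} with hT
    have hTm : MeasurableSet T := measurableSet_lt measurable_const hGm
    have hT0 : μ T ≠ 0 := fun h0 => hcon (by
      rw [ae_iff]; simpa only [not_le] using h0)
    have hTr : 0 < μ.real T := ENNReal.toReal_pos hT0 (measure_ne_top _ _)
    -- Spending the whole budget uniformly on the set where the marginal exceeds `lam` would beat
    -- the optimal value `lam * A`.
    have hfeas : IsFeasible μ A (T.indicator fun _ => A / μ.real T) := by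
      refine ⟨measurable_const.indicator hTm,
        fun g => Set.indicator_nonneg (fun _ _ => by positivity) g,
        (integrable_const _).indicator hTm, ?_⟩
      rw [integral_indicator_const _ hTm, smul_eq_mul]
      exact le_of_eq (by field_simp)
    have hint : ∫ g, T.indicator (fun _ => A / μ.real T) g ∂μ = A := by
      rw [integral_indicator_const _ hTm, smul_eq_mul]; field_simp
    obtain ⟨h1, h2⟩ := hvar hfeas
    have h3 : 0 ≤ᵐ[μ] fun g => G g * T.indicator (fun _ => A / μ.real T) g -
        lam * T.indicator (fun _ => A / μ.real T) g := by
      refine Filter.Eventually.of_forall fun g => ?_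
      by_cases hg : g ∈ T
      · simp only [Set.indicator_of_mem hg, ← sub_mul]
        exact mul_nonneg (sub_nonneg.2 (le_of_lt hg)) (by positivity)
      · simp [Set.indicator_of_notMem hg]
    have h4 : ∫ g, (G g * T.indicator (fun _ => A / μ.real T) g -
        lam * T.indicator (fun _ => A / μ.real T) g) ∂μ = 0 := by
      apply le_antisymm _ (integral_nonneg_of_ae h3)
      rw [integral_sub h1 (hfeas.2.2.1.const_mul lam), integral_const_mul, hint]
      linarith
    rw [integral_eq_zero_iff_of_nonneg_ae h3 (h1.sub (hfeas.2.2.1.const_mul lam))] at h4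
    refine hT0 (measure_eq_zero_iff_ae_notMem.2 (h4.mono fun g hg hgT => ?_))
    simp only [Set.indicator_of_mem hgT, ← sub_mul, Pi.zero_apply] at hg
    have : 0 < (G g - lam) * (A / μ.real T) := mul_pos (sub_pos.2 hgT) (by positivity)
    linarith
  have hlampos : 0 < lam := by
    obtain ⟨g, h1, h2⟩ := (hGpos.and hle).exists
    exact h1.trans_le h2
  -- Complementary slackness: the integrand is nonnegative, and its integral is at most `lam * A -
  -- lam * A = 0`.
  have hcs : ∀ᵐ g ∂μ, (lam - G g) * p g = 0 := by
    have h1 : Integrable (fun g => lam * p g - G g * p g) μ := (hp.2.2.1.const_mul lam).sub hGp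
    have h2 : 0 ≤ᵐ[μ] fun g => lam * p g - G g * p g := by
      filter_upwards [hle] with g hg
      simp only [← sub_mul]
      exact mul_nonneg (sub_nonneg.2 hg) (hp.2.1 g)
    have h3 : ∫ g, (lam * p g - G g * p g) ∂μ = 0 := by
      apply le_antisymm _ (integral_nonneg_of_ae h2)
      rw [integral_sub (hp.2.2.1.const_mul lam) hGp, integral_const_mul, hlamA]
      have := mul_le_mul_of_nonneg_left hp.2.2.2 hlam0
      linarith
    rw [integral_eq_zero_iff_of_nonneg_ae h2 h1] at h3
    filter_upwards [h3] with g hg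
    simpa only [sub_mul, Pi.zero_apply] using hg
  refine ⟨lam, hlampos, ?_, fun h0 => ?_⟩
  · filter_upwards [hle, hcs] with g h1 h2
    refine ⟨h1, fun h3 => ?_⟩
    have := (mul_eq_zero.1 h2).resolve_right h3.ne'
    change G g = lam
    linarith
  · have : ∫ g, G g * p g ∂μ = 0 := by
      rw [integral_congr_ae (g := fun _ => (0 : ℝ)) (h0.mono fun g hg => by simp [hg])]
      simp
    rw [this] at hlamA
    nlinarith [mul_pos hlampos hA]

end SumRate

/-! ### Determinants of two-user covariances -/

/-- The rank-two perturbation factors through a two-dimensional space, and `det (1 + M N) = det (1 +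
N M)` reduces the computation to a two-by-two determinant. -/
theorem det_one_add_two_rankOne {n : ℕ} (v w : Fin n → ℝ) (x y : ℝ) :
    Matrix.det ((1 : Matrix (Fin n) (Fin n) ℝ) +
      (x • Matrix.vecMulVec v v + y • Matrix.vecMulVec w w)) =
    1 + x * (v ⬝ᵥ v) + y * (w ⬝ᵥ w) + x * y * ((v ⬝ᵥ v) * (w ⬝ᵥ w) - (v ⬝ᵥ w) ^ 2) := by
  set M : Matrix (Fin n) (Fin 2) ℝ := Matrix.of fun r k => ![x * v r, y * w r] k with hM
  set N : Matrix (Fin 2) (Fin n) ℝ := Matrix.of ![v, w] with hN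
  have h1 : x • Matrix.vecMulVec v v + y • Matrix.vecMulVec w w = M * N := by
    ext r s
    simp [hM, hN, Matrix.mul_apply, Fin.sum_univ_two, Matrix.vecMulVec_apply]
    ring
  have e : ∀ (z : ℝ) (f h : Fin n → ℝ), ∑ r, f r * (z * h r) = z * (f ⬝ᵥ h) := by
    intro z f h
    rw [dotProduct, Finset.mul_sum]
    exact Finset.sum_congr rfl fun r _ => by ring
  rw [h1, Matrix.det_one_add_mul_comm, Matrix.det_fin_two]
  simp only [Matrix.add_apply, Matrix.mul_apply, hM, hN, Matrix.of_apply, Matrix.cons_val_zero,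
    Matrix.cons_val_one, Matrix.one_apply_eq, e, Matrix.one_apply_ne (zero_ne_one (α := Fin 2)),
    Matrix.one_apply_ne (one_ne_zero (α := Fin 2))]
  rw [dotProduct_comm w v]
  ring

/-- The power gain of a vector of antenna gains, relative to the noise level `σ ^ 2`. -/
noncomputable def powerGain {Nr : ℕ} (σ : ℝ) (x : Fin Nr → ℝ) : ℝ :=
  (∑ r, Real.sqrt (x r) ^ 2) / σ ^ 2

/-- The squared correlation of the two fading vectors, relative to the noise. -/
noncomputable def crossGain {Nr : ℕ} (σ : ℝ) (g : Gains Nr) : ℝ :=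
  (fadingVec g 0 ⬝ᵥ fadingVec g 1) ^ 2 / σ ^ 4

/-- The Gram determinant of the two fading vectors, relative to the noise. -/
noncomputable def gramDet {Nr : ℕ} (σ : ℝ) (g : Gains Nr) : ℝ :=
  powerGain σ (g 0) * powerGain σ (g 1) - crossGain σ g

/-- The policies of the users in `S`, the other users being silent. -/
noncomputable def restrictUsers {Nr : ℕ} (S : Finset (Fin 2)) (P : Fin 2 → Gains Nr → ℝ) :
    Fin 2 → Gains Nr → ℝ :=
  fun i g => if i ∈ S then P i g else 0

section Bridge

variable {Nr : ℕ} {μ : Measure (Gains Nr)} {σ : ℝ} {Pbar : Fin 2 → ℝ}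
  {P Q : Fin 2 → Gains Nr → ℝ}

theorem powerGain_eq_dotProduct (g : Gains Nr) (i : Fin 2) :
    powerGain σ (g i) = (fadingVec g i ⬝ᵥ fadingVec g i) / σ ^ 2 := by
  unfold powerGain fadingVec dotProduct
  simp only [sq]

theorem det_one_add_signalCov (hσ : 0 < σ) (S : Finset (Fin 2)) (P : Fin 2 → Gains Nr → ℝ)
    (g : Gains Nr) :
    Matrix.det ((1 : Matrix (Fin Nr) (Fin Nr) ℝ) + (1 / σ ^ 2) • signalCov S P g) =
      rxDet (powerGain σ (g 0)) (powerGain σ (g 1)) (gramDet σ g)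
        (restrictUsers S P 0 g) (restrictUsers S P 1 g) := by
  have h1 : (1 / σ ^ 2) • signalCov S P g =
      (1 / σ ^ 2 * restrictUsers S P 0 g) • Matrix.vecMulVec (fadingVec g 0) (fadingVec g 0) +
      (1 / σ ^ 2 * restrictUsers S P 1 g) • Matrix.vecMulVec (fadingVec g 1) (fadingVec g 1) := by
    have h2 : signalCov S P g = ∑ i, restrictUsers S P i g •
        Matrix.vecMulVec (fadingVec g i) (fadingVec g i) := by
      unfold signalCov restrictUsers
      simp only [ite_smul, zero_smul, Finset.sum_ite_mem, Finset.univ_inter]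
    rw [h2, Fin.sum_univ_two, smul_add, smul_smul, smul_smul]
  rw [h1, det_one_add_two_rankOne]
  unfold gramDet crossGain rxDet
  rw [powerGain_eq_dotProduct, powerGain_eq_dotProduct]
  field_simp

theorem det_noise_add_signalCov (hσ : 0 < σ) (S : Finset (Fin 2)) (P : Fin 2 → Gains Nr → ℝ)
    (g : Gains Nr) :
    Matrix.det (σ ^ 2 • (1 : Matrix (Fin Nr) (Fin Nr) ℝ) + signalCov S P g) =
      (σ ^ 2) ^ Nr * rxDet (powerGain σ (g 0)) (powerGain σ (g 1)) (gramDet σ g)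
        (restrictUsers S P 0 g) (restrictUsers S P 1 g) := by
  rw [← det_one_add_signalCov hσ]
  have h : σ ^ 2 • (1 : Matrix (Fin Nr) (Fin Nr) ℝ) + signalCov S P g =
      σ ^ 2 • ((1 : Matrix (Fin Nr) (Fin Nr) ℝ) + (1 / σ ^ 2) • signalCov S P g) := by
    rw [smul_add, smul_smul, mul_one_div_cancel (by positivity), one_smul]
  rw [h, Matrix.det_smul, Fintype.card_fin]

/-! ### Regularity of the channel coefficients -/

theorem continuous_powerGain : Continuous (powerGain σ : (Fin Nr → ℝ) → ℝ) := by
  unfold powerGain; fun_prop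

theorem continuous_crossGain : Continuous (crossGain σ : Gains Nr → ℝ) := by
  unfold crossGain fadingVec dotProduct; fun_prop

theorem continuous_gramDet : Continuous (gramDet σ : Gains Nr → ℝ) := by
  have := continuous_crossGain (σ := σ) (Nr := Nr)
  have := continuous_powerGain (σ := σ) (Nr := Nr)
  unfold gramDet; fun_prop

theorem powerGain_eq_of_nonneg {x : Fin Nr → ℝ} (hx : ∀ r, 0 ≤ x r) :
    powerGain σ x = 1 / σ ^ 2 * ∑ r, x r := by
  unfold powerGain
  rw [Finset.sum_congr rfl fun r _ => Real.sq_sqrt (hx r)]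
  ring

theorem powerGain_pos (hσ : 0 < σ) {x : Fin Nr → ℝ} (hx : ∀ r, 0 < x r) (r₀ : Fin Nr) :
    0 < powerGain σ x := by
  rw [powerGain_eq_of_nonneg fun r => (hx r).le]
  have : 0 < ∑ r, x r := Finset.sum_pos (fun r _ => hx r) ⟨r₀, Finset.mem_univ _⟩
  positivity

theorem crossGain_nonneg (g : Gains Nr) : 0 ≤ crossGain σ g := by
  unfold crossGain; positivity

theorem crossGain_pos (hσ : 0 < σ) {g : Gains Nr} (hg : ∀ i r, 0 < g i r) (r₀ : Fin Nr) :
    0 < crossGain σ g := by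
  have : 0 < fadingVec g 0 ⬝ᵥ fadingVec g 1 :=
    Finset.sum_pos (fun r _ => mul_pos (Real.sqrt_pos.2 (hg 0 r)) (Real.sqrt_pos.2 (hg 1 r)))
      ⟨r₀, Finset.mem_univ _⟩
  unfold crossGain; positivity

/-- Strict Cauchy-Schwarz: the squared norm of `(v ⬝ᵥ v) w - (v ⬝ᵥ w) v` is `v ⬝ᵥ v` times the Gram
determinant. Were the latter nonpositive, this vector would vanish and every two-by-two minor of
`v`, `w` would be zero. -/
theorem dotProduct_sq_lt_of_not_parallel {n : ℕ} {v w : Fin n → ℝ} (hv : 0 < v ⬝ᵥ v)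
    {r s : Fin n} (h : v r * w s ≠ v s * w r) : (v ⬝ᵥ w) ^ 2 < (v ⬝ᵥ v) * (w ⬝ᵥ w) := by
  by_contra hcon
  push Not at hcon
  have e : ∑ t, ((v ⬝ᵥ v) * w t - (v ⬝ᵥ w) * v t) ^ 2 =
      (v ⬝ᵥ v) * ((v ⬝ᵥ v) * (w ⬝ᵥ w) - (v ⬝ᵥ w) ^ 2) := by
    have e1 : ∀ t, ((v ⬝ᵥ v) * w t - (v ⬝ᵥ w) * v t) ^ 2 = (v ⬝ᵥ v) ^ 2 * (w t * w t) -
        2 * (v ⬝ᵥ v) * (v ⬝ᵥ w) * (v t * w t) + (v ⬝ᵥ w) ^ 2 * (v t * v t) := fun t => by ring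
    simp only [e1, Finset.sum_add_distrib, Finset.sum_sub_distrib, ← Finset.mul_sum]
    change (v ⬝ᵥ v) ^ 2 * (w ⬝ᵥ w) - 2 * (v ⬝ᵥ v) * (v ⬝ᵥ w) * (v ⬝ᵥ w) +
      (v ⬝ᵥ w) ^ 2 * (v ⬝ᵥ v) = _
    ring
  have h0 : ∑ t, ((v ⬝ᵥ v) * w t - (v ⬝ᵥ w) * v t) ^ 2 = 0 :=
    le_antisymm (by rw [e]; exact mul_nonpos_of_nonneg_of_nonpos hv.le (by linarith))
      (Finset.sum_nonneg fun t _ => sq_nonneg _)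
  rw [Finset.sum_eq_zero_iff_of_nonneg fun t _ => sq_nonneg _] at h0
  have hr := pow_eq_zero_iff two_ne_zero |>.1 (h0 r (Finset.mem_univ _))
  have hs := pow_eq_zero_iff two_ne_zero |>.1 (h0 s (Finset.mem_univ _))
  apply h
  apply mul_left_cancel₀ hv.ne'
  linear_combination v r * hs - v s * hr

theorem gramDet_pos (hσ : 0 < σ) {g : Gains Nr} (hg : ∀ i r, 0 < g i r) {r s : Fin Nr}
    (h : g 0 r * g 1 s ≠ g 0 s * g 1 r) : 0 < gramDet σ g := by
  have hv : 0 < fadingVec g 0 ⬝ᵥ fadingVec g 0 :=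
    Finset.sum_pos (fun r _ => mul_pos (Real.sqrt_pos.2 (hg 0 r)) (Real.sqrt_pos.2 (hg 0 r)))
      ⟨r, Finset.mem_univ _⟩
  have := dotProduct_sq_lt_of_not_parallel (v := fadingVec g 0) (w := fadingVec g 1) hv
    (r := r) (s := s) (by
      unfold fadingVec
      rw [← Real.sqrt_mul (hg 0 r).le, ← Real.sqrt_mul (hg 0 s).le]
      intro hsq
      exact h ((Real.sqrt_inj (mul_pos (hg 0 r) (hg 1 s)).le (mul_pos (hg 0 s) (hg 1 r)).le).1 hsq))
  unfold gramDet crossGain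
  rw [powerGain_eq_dotProduct, powerGain_eq_dotProduct, div_mul_div_comm, ← pow_add, ← sub_div]
  exact div_pos (by linarith) (by positivity)

open Filter Topology in
/-- A measurable set that meets each line in a fixed direction at most once is null. -/
theorem volume_eq_zero_of_lines {s : Set (Gains Nr)} (hs : MeasurableSet s) (u : Gains Nr)
    (h : ∀ x ∈ s, ∀ t : ℝ, t ≠ 0 → x + t • u ∉ s) : volume s = 0 := by
  have hlim : Tendsto (fun n : ℕ => (1 / ((n : ℝ) + 1)) • u) atTop (𝓝 ((0 : ℝ) • u)) :=
    tendsto_one_div_add_atTop_nhds_zero_nat.smul_const u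
  -- The translates by `u / (n + 1)` are pairwise disjoint and the shifts stay bounded, so positive
  -- measure is impossible.
  refine Measure.addHaar_eq_zero_of_disjoint_translates volume
    (fun n : ℕ => (1 / ((n : ℝ) + 1)) • u) (Metric.isBounded_range_of_tendsto _ hlim) ?_ hs
  intro m n hmn
  rw [Function.onFun, Set.disjoint_left]
  rintro _ ⟨_, rfl, x, hx, rfl⟩ ⟨_, rfl, y, hy, hxy⟩
  simp only at hxy
  refine h x hx (1 / ((m : ℝ) + 1) - 1 / ((n : ℝ) + 1)) ?_ ?_
  · rw [sub_ne_zero]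
    intro heq
    have h1 : ((m : ℝ) + 1) = (n : ℝ) + 1 := by
      rwa [one_div, one_div, inv_inj] at heq
    exact hmn (by exact_mod_cast add_right_cancel h1)
  · have : x + (1 / ((m : ℝ) + 1) - 1 / ((n : ℝ) + 1)) • u = y := by
      rw [sub_smul, add_sub, sub_eq_iff_eq_add, add_comm x, ← hxy, add_comm]
    rwa [this]

theorem volume_gain_eq_zero (i : Fin 2) (r : Fin Nr) :
    volume {g : Gains Nr | g i r = 0} = 0 := by
  refine volume_eq_zero_of_lines (measurableSet_eq_fun (by fun_prop) measurable_const)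
    (Pi.single i (Pi.single r 1)) fun x hx t ht hxt => ht ?_
  simp only [Set.mem_ofPred_eq, Pi.add_apply, Pi.smul_apply, Pi.single_eq_same, smul_eq_mul] at hx hxt
  linarith

/-- Shifting the single gain `g 0 r` by `t` changes the equation by `t * g 1 s`, so each line in
that direction meets the set at most once; this is why `g 1 s ≠ 0` is included. -/
theorem volume_parallel_eq_zero {r s : Fin Nr} (hrs : r ≠ s) :
    volume {g : Gains Nr | g 0 r * g 1 s = g 0 s * g 1 r ∧ g 1 s ≠ 0} = 0 := by
  refine volume_eq_zero_of_lines ((measurableSet_eq_fun (by fun_prop) (by fun_prop)).inter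
    (measurableSet_eq_fun (by fun_prop) measurable_const).compl)
    (Pi.single 0 (Pi.single r 1)) fun x hx t ht hxt => ?_
  have e1 : (x + t • (Pi.single 0 (Pi.single r 1) : Gains Nr)) 0 r = x 0 r + t := by simp
  have e2 : (x + t • (Pi.single 0 (Pi.single r 1) : Gains Nr)) 0 s = x 0 s := by
    simp [Pi.single_eq_of_ne hrs.symm]
  have e3 : ∀ k, (x + t • (Pi.single 0 (Pi.single r 1) : Gains Nr)) 1 k = x 1 k := by
    intro k; simp
  rw [Set.mem_ofPred_eq, e1, e2, e3, e3] at hxt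
  have h1 := hx.1
  have : t * x 1 s = 0 := by linarith [hxt.1]
  exact (mul_ne_zero ht hx.2) this

/-- Almost surely all gains are positive and the two fading vectors are not parallel. -/
theorem ae_gains_generic (hdens : μ ≪ volume) (hnonneg : ∀ᵐ g ∂μ, ∀ i r, 0 ≤ g i r)
    {r s : Fin Nr} (hrs : r ≠ s) :
    ∀ᵐ g ∂μ, (∀ i r, 0 < g i r) ∧ g 0 r * g 1 s ≠ g 0 s * g 1 r := by
  have h1 : ∀ᵐ g ∂μ, ∀ i r, g i r ≠ 0 := by
    rw [ae_all_iff]; intro i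
    rw [ae_all_iff]; intro r
    rw [ae_iff]
    simpa using hdens (volume_gain_eq_zero i r)
  have h2 := measure_eq_zero_iff_ae_notMem.1 (hdens (volume_parallel_eq_zero hrs))
  filter_upwards [hnonneg, h1, h2] with g hg0 hg1 hg2
  have hpos : ∀ i r, 0 < g i r := fun i r => lt_of_le_of_ne (hg0 i r) (hg1 i r).symm
  exact ⟨hpos, fun h => hg2 ⟨h, (hpos 1 s).ne'⟩⟩

theorem isChannel_of_gains [IsProbabilityMeasure μ] (hNr : 2 ≤ Nr) (hdens : μ ≪ volume)
    (hnonneg : ∀ᵐ g ∂μ, ∀ i r, 0 ≤ g i r)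
    (hlog : ∀ i, Integrable (fun g : Gains Nr => Real.log (1 + ∑ r, g i r)) μ) (hσ : 0 < σ) :
    IsChannel μ (fun g => powerGain σ (g 0)) (fun g => powerGain σ (g 1)) (gramDet σ) := by
  have hmeas : ∀ i, Measurable fun g : Gains Nr => powerGain σ (g i) := fun i =>
    (continuous_powerGain.comp (continuous_apply i)).measurable
  have hrs : (⟨0, by omega⟩ : Fin Nr) ≠ ⟨1, by omega⟩ := by simp
  have hgen := ae_gains_generic hdens hnonneg hrs
  have hint : ∀ i, Integrable (fun g : Gains Nr => Real.log (1 + powerGain σ (g i))) μ := by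
    intro i
    refine ((integrable_const (Real.log (1 + 1 / σ ^ 2))).add (hlog i)).mono'
      ((hmeas i).const_add 1).log.aestronglyMeasurable ?_
    filter_upwards [hgen] with g hg
    have h1 := powerGain_pos hσ (hg.1 i) ⟨0, by omega⟩
    rw [Real.norm_of_nonneg (Real.log_nonneg (by linarith)),
      powerGain_eq_of_nonneg fun r => (hg.1 i r).le]
    exact log_one_add_mul_le (by positivity) (Finset.sum_nonneg fun r _ => (hg.1 i r).le)
  refine ⟨hmeas 0, hmeas 1, continuous_gramDet.measurable, ?_, hint 0, hint 1⟩
  filter_upwards [hgen] with g hg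
  refine ⟨powerGain_pos hσ (hg.1 0) ⟨0, by omega⟩, powerGain_pos hσ (hg.1 1) ⟨0, by omega⟩,
    gramDet_pos hσ hg.1 hg.2, ?_⟩
  have := crossGain_nonneg (σ := σ) g
  unfold gramDet; linarith

/-! ### Rate bounds and payoffs as sum-rates -/

/-- The sum-rate of the users in terms of the power gains. -/
noncomputable def gainSumRate (μ : Measure (Gains Nr)) (σ : ℝ) (P : Fin 2 → Gains Nr → ℝ) : ℝ :=
  sumRate μ (fun g => powerGain σ (g 0)) (fun g => powerGain σ (g 1)) (gramDet σ) (P 0) (P 1)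

theorem groupBound_eq (hσ : 0 < σ) (S : Finset (Fin 2)) (P : Fin 2 → Gains Nr → ℝ) :
    groupBound μ σ S P = 1 / (2 * Real.log 2) * gainSumRate μ σ (restrictUsers S P) := by
  unfold groupBound gainSumRate sumRate
  rw [← integral_const_mul]
  congr 1
  funext g
  rw [det_one_add_signalCov hσ, Real.logb]
  ring

theorem restrictUsers_univ (P : Fin 2 → Gains Nr → ℝ) : restrictUsers Finset.univ P = P := by
  funext i g; simp [restrictUsers]

theorem isFeasible_restrictUsers (hP : ∀ i, IsFeasible μ (Pbar i) (P i)) (S : Finset (Fin 2))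
    (hPbar : ∀ i, 0 < Pbar i) (i : Fin 2) : IsFeasible μ (Pbar i) (restrictUsers S P i) := by
  by_cases h : i ∈ S
  · have : restrictUsers S P i = P i := by funext g; simp [restrictUsers, h]
    rw [this]; exact hP i
  · have : restrictUsers S P i = fun _ => 0 := by funext g; simp [restrictUsers, h]
    rw [this]; exact isFeasible_zero (hPbar i).le

theorem groupBound_congr_ae {S : Finset (Fin 2)} (h : ∀ i, P i =ᵐ[μ] Q i) :
    groupBound μ σ S P = groupBound μ σ S Q := by
  apply integral_congr_ae
  filter_upwards [ae_all_iff.2 h] with g hg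
  simp only [signalCov, hg]

/-- The interference term is untouched by a deviation of user `i`: this is the potential structure
of the game. -/
theorem groupBound_update_compl (i : Fin 2) (q : Gains Nr → ℝ) :
    groupBound μ σ {i}ᶜ (Function.update P i q) = groupBound μ σ {i}ᶜ P := by
  have : ∀ g, signalCov {i}ᶜ (Function.update P i q) g = signalCov {i}ᶜ P g := by
    intro g
    refine Finset.sum_congr rfl fun k hk => ?_
    rw [Function.update_of_ne (by simpa using hk)]
  simp only [groupBound, this]

/-- The channel coefficients belonging to the power gains are admissible. -/
abbrev IsGainChannel (μ : Measure (Gains Nr)) (σ : ℝ) : Prop :=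
  IsChannel μ (fun g => powerGain σ (g 0)) (fun g => powerGain σ (g 1)) (gramDet σ)

variable [IsProbabilityMeasure μ]

/-- Both determinants carry the same noise factor `(σ ^ 2) ^ Nr`, which cancels in the difference of
logarithms. -/
theorem payoff_eq (h : IsGainChannel μ σ) (hσ : 0 < σ) (hPbar : ∀ i, 0 < Pbar i)
    (hP : ∀ i, IsFeasible μ (Pbar i) (P i)) (i : Fin 2) :
    payoff μ σ i P = groupBound μ σ Finset.univ P - groupBound μ σ {i}ᶜ P := by
  have hS : ∀ S, Integrable (fun g : Gains Nr => 1 / (2 * Real.log 2) *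
      Real.log (rxDet (powerGain σ (g 0)) (powerGain σ (g 1)) (gramDet σ g)
        (restrictUsers S P 0 g) (restrictUsers S P 1 g))) μ := fun S =>
    (integrable_log_rxDet h (isFeasible_restrictUsers hP S hPbar 0)
      (isFeasible_restrictUsers hP S hPbar 1)).const_mul _
  rw [groupBound_eq hσ, groupBound_eq hσ, gainSumRate, gainSumRate, sumRate, sumRate,
    ← integral_const_mul, ← integral_const_mul, ← integral_sub (hS _) (hS _)]
  apply integral_congr_ae
  filter_upwards [h.ae_pos] with g ⟨ha, hb, hd, _⟩
  have hD : ∀ S : Finset (Fin 2), rxDet (powerGain σ (g 0)) (powerGain σ (g 1)) (gramDet σ g)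
      (restrictUsers S P 0 g) (restrictUsers S P 1 g) ≠ 0 := fun S =>
    (rxDet_pos ha hb hd ((isFeasible_restrictUsers hP S hPbar 0).2.1 g)
      ((isFeasible_restrictUsers hP S hPbar 1).2.1 g)).ne'
  rw [det_noise_add_signalCov hσ, det_noise_add_signalCov hσ, Real.logb, Real.logb,
    Real.log_mul (by positivity) (hD _), Real.log_mul (by positivity) (hD _)]
  ring

theorem gainSumRate_mono (h : IsGainChannel μ σ) (hP : ∀ i, IsFeasible μ (Pbar i) (P i))
    (hQ : ∀ i, IsFeasible μ (Pbar i) (Q i)) (hPQ : ∀ i g, P i g ≤ Q i g) :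
    gainSumRate μ σ P ≤ gainSumRate μ σ Q := by
  apply integral_mono_ae (integrable_log_rxDet h (hP 0) (hP 1)) (integrable_log_rxDet h (hQ 0) (hQ 1))
  filter_upwards [h.ae_pos] with g ⟨ha, hb, hd, _⟩
  apply Real.log_le_log (rxDet_pos ha hb hd ((hP 0).2.1 g) ((hP 1).2.1 g))
  have h1 := (hP 0).2.1 g
  have h2 := (hP 1).2.1 g
  have h3 := hPQ 0 g
  have h4 := hPQ 1 g
  have h5 := (hQ 0).2.1 g
  unfold rxDet
  gcongr

theorem groupBound_mono (h : IsGainChannel μ σ) (hσ : 0 < σ) (hPbar : ∀ i, 0 < Pbar i)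
    (hP : ∀ i, IsFeasible μ (Pbar i) (P i)) {S T : Finset (Fin 2)} (hST : S ⊆ T) :
    groupBound μ σ S P ≤ groupBound μ σ T P := by
  rw [groupBound_eq hσ, groupBound_eq hσ]
  refine mul_le_mul_of_nonneg_left (gainSumRate_mono h (isFeasible_restrictUsers hP S hPbar)
    (isFeasible_restrictUsers hP T hPbar) fun i g => ?_)
    (by have := Real.log_pos (one_lt_two (α := ℝ)); positivity)
  unfold restrictUsers
  by_cases hi : i ∈ S
  · simp [hi, hST hi]
  · rw [if_neg hi]
    split_ifs
    · exact (hP i).2.1 g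
    · exact le_rfl

omit [IsProbabilityMeasure μ] in
theorem groupBound_empty (P : Fin 2 → Gains Nr → ℝ) : groupBound μ σ ∅ P = 0 := by
  simp [groupBound, signalCov]

/-- Pointwise, `(1 + a p) (1 + b q)` exceeds the joint determinant by exactly the cross gain times
`p q`. Equality of the means therefore forces this term to vanish almost everywhere. -/
theorem gainSumRate_singleton_add (h : IsGainChannel μ σ) (hPbar : ∀ i, 0 < Pbar i)
    (hP : ∀ i, IsFeasible μ (Pbar i) (P i)) :
    gainSumRate μ σ P ≤ gainSumRate μ σ (restrictUsers {0} P) +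
      gainSumRate μ σ (restrictUsers {1} P) ∧
    (gainSumRate μ σ P = gainSumRate μ σ (restrictUsers {0} P) +
      gainSumRate μ σ (restrictUsers {1} P) →
      ∀ᵐ g ∂μ, crossGain σ g * (P 0 g * P 1 g) = 0) := by
  have i0 := integrable_log_rxDet h (hP 0) (hP 1)
  have i1 := integrable_log_rxDet h (isFeasible_restrictUsers hP {0} hPbar 0)
    (isFeasible_restrictUsers hP {0} hPbar 1)
  have i2 := integrable_log_rxDet h (isFeasible_restrictUsers hP {1} hPbar 0)
    (isFeasible_restrictUsers hP {1} hPbar 1)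
  have i12 : Integrable (fun g => Real.log (rxDet (powerGain σ (g 0)) (powerGain σ (g 1))
      (gramDet σ g) (restrictUsers {0} P 0 g) (restrictUsers {0} P 1 g)) +
      Real.log (rxDet (powerGain σ (g 0)) (powerGain σ (g 1))
      (gramDet σ g) (restrictUsers {1} P 0 g) (restrictUsers {1} P 1 g))) μ := i1.add i2
  have e1 : ∀ g, rxDet (powerGain σ (g 0)) (powerGain σ (g 1)) (gramDet σ g)
      (restrictUsers {0} P 0 g) (restrictUsers {0} P 1 g) = 1 + powerGain σ (g 0) * P 0 g := by
    intro g; simp [restrictUsers, rxDet]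
  have e2 : ∀ g, rxDet (powerGain σ (g 0)) (powerGain σ (g 1)) (gramDet σ g)
      (restrictUsers {1} P 0 g) (restrictUsers {1} P 1 g) = 1 + powerGain σ (g 1) * P 1 g := by
    intro g; simp [restrictUsers, rxDet]
  have hle : ∀ᵐ g ∂μ, 0 ≤ Real.log (rxDet (powerGain σ (g 0)) (powerGain σ (g 1))
      (gramDet σ g) (restrictUsers {0} P 0 g) (restrictUsers {0} P 1 g)) +
      Real.log (rxDet (powerGain σ (g 0)) (powerGain σ (g 1))
      (gramDet σ g) (restrictUsers {1} P 0 g) (restrictUsers {1} P 1 g)) -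
      Real.log (rxDet (powerGain σ (g 0)) (powerGain σ (g 1)) (gramDet σ g) (P 0 g) (P 1 g)) := by
    filter_upwards [h.ae_pos] with g ⟨ha, hb, hd, hab⟩
    rw [e1, e2]
    exact sub_nonneg.2 (log_rxDet_le ha hb hd hab ((hP 0).2.1 g) ((hP 1).2.1 g))
  have hval := integral_sub i12 i0
  rw [integral_add i1 i2] at hval
  change _ = gainSumRate μ σ (restrictUsers {0} P) + gainSumRate μ σ (restrictUsers {1} P) -
      gainSumRate μ σ P at hval
  refine ⟨?_, fun heq => ?_⟩
  · have := integral_nonneg_of_ae hle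
    linarith
  · rw [← heq, sub_self] at hval
    have hz := (integral_eq_zero_iff_of_nonneg_ae hle (i12.sub i0)).1 hval
    filter_upwards [hz, h.ae_pos] with g hg ⟨ha, hb, hd, _⟩
    have h0 := (hP 0).2.1 g
    have h1 := (hP 1).2.1 g
    have hx : 0 < 1 + powerGain σ (g 0) * P 0 g := by positivity
    have hy : 0 < 1 + powerGain σ (g 1) * P 1 g := by positivity
    rw [e1, e2, ← Real.log_mul hx.ne' hy.ne', Pi.zero_apply, sub_eq_zero] at hg
    have hinj := Real.log_injOn_pos (Set.mem_Ioi.2 (mul_pos hx hy))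
      (Set.mem_Ioi.2 (rxDet_pos ha hb hd h0 h1)) hg
    unfold rxDet gramDet at hinj
    linarith

end Bridge

/-! ### Both users transmit simultaneously with positive probability -/

/-- Kuhn-Tucker conditions at a state where only the first user transmits. -/
theorem kuhnTucker_single_user {a b d p lam lam' : ℝ} (ha : 0 < a) (hd : 0 < d)
    (hp : 0 < p) (hlam : 0 < lam) (h1 : marginal a b d p 0 = lam)
    (h2 : marginal b a d 0 p ≤ lam') :
    lam < a ∧ (b - lam') * a ^ 2 ≤ (a * b - d) * (a - lam) ∧ lam * b < lam' * a := by
  have hD : 0 < 1 + a * p := by positivity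
  have e1 : a = lam * (1 + a * p) := by
    rw [marginal, rxDet, div_eq_iff (by nlinarith)] at h1
    linarith
  have hla : lam < a := by
    have : 0 < lam * (a * p) := by positivity
    nlinarith
  have e2 : b + d * p ≤ lam' * (1 + a * p) := by
    rw [marginal, rxDet, div_le_iff₀ (by nlinarith)] at h2
    linarith
  -- The power `p` is eliminated through `a = lam (1 + a p)`, leaving conditions on the gains and
  -- multipliers alone.
  have e3 : lam * (b + d * p) ≤ lam' * a := by
    calc lam * (b + d * p) ≤ lam * (lam' * (1 + a * p)) := by gcongr
      _ = lam' * (lam * (1 + a * p)) := by ring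
      _ = lam' * a := by rw [← e1]
  refine ⟨hla, ?_, ?_⟩
  · have e4 := mul_le_mul_of_nonneg_left e3 ha.le
    have e5 : lam * (a * p) = a - lam := by linarith
    have e6 : a * (lam * (b + d * p)) = a * b * lam + d * (a - lam) := by rw [← e5]; ring
    rw [e6] at e4
    nlinarith
  · have : 0 < lam * (d * p) := by positivity
    linarith

section Support

variable {Nr : ℕ} {μ : Measure (Gains Nr)} {σ : ℝ} {Pbar : Fin 2 → ℝ}
  {P : Fin 2 → Gains Nr → ℝ}

open Filter Topology in
theorem exists_pos_smul_mem_of_isOpen {E : Type*} [NormedAddCommGroup E] [NormedSpace ℝ E]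
    {U : Set E} (hU : IsOpen U) {x : E} (hx : x ∈ U) (w : E) : ∃ t : ℝ, 0 < t ∧ x + t • w ∈ U := by
  have hc : Continuous fun t : ℝ => x + t • w := by fun_prop
  have h0 : ∀ᶠ t in 𝓝 (0 : ℝ), x + t • w ∈ U :=
    hc.continuousAt.eventually_mem (hU.mem_nhds (by simpa using hx))
  obtain ⟨t, ht1, ht2⟩ := ((h0.filter_mono nhdsWithin_le_nhds).and
    (self_mem_nhdsWithin : Set.Ioi (0 : ℝ) ∈ 𝓝[>] 0)).exists
  exact ⟨t, ht2, ht1⟩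

/-- An open set of the support that is null for the law is empty. -/
theorem eq_empty_of_isOpen_null {V O : Set (Gains Nr)} (hV : volume.restrict V ≪ μ)
    (hO : IsOpen O) (hOV : O ⊆ V) (h : μ O = 0) : O = ∅ := by
  have h1 := hV h
  rw [Measure.restrict_eq_self _ hOV] at h1
  exact (hO.measure_eq_zero_iff volume).1 h1

/-- A negative gain would hold on a nonempty open part of the support, which the law charges. A zero
gain becomes negative after a small move inside the open set. -/
theorem gains_pos_of_mem_support {V : Set (Gains Nr)} (hVo : IsOpen V)
    (hV : volume.restrict V ≪ μ) (hnonneg : ∀ᵐ g ∂μ, ∀ i r, 0 ≤ g i r) {g : Gains Nr}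
    (hg : g ∈ V) (i : Fin 2) (r : Fin Nr) : 0 < g i r := by
  have hnn : ∀ g ∈ V, 0 ≤ g i r := by
    intro g hg
    by_contra hcon
    have hO : IsOpen (V ∩ {g | g i r < 0}) := hVo.inter (isOpen_lt (by fun_prop) continuous_const)
    have h0 : μ (V ∩ {g | g i r < 0}) = 0 :=
      measure_eq_zero_iff_ae_notMem.2 (hnonneg.mono fun g hg hg' => not_lt.2 (hg i r) hg'.2)
    have := eq_empty_of_isOpen_null hV hO Set.inter_subset_left h0
    exact (this ▸ ⟨hg, not_le.1 hcon⟩ : g ∈ (∅ : Set (Gains Nr)))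
  obtain ⟨t, ht, htV⟩ := exists_pos_smul_mem_of_isOpen hVo hg (-Pi.single i (Pi.single r 1))
  have := hnn _ htV
  simp only [Pi.add_apply, Pi.smul_apply, Pi.neg_apply, Pi.single_eq_same, smul_eq_mul] at this
  linarith

/-- At a point of a product of open sets, one can make the two fading vectors non-parallel
without changing the power gains. -/
theorem exists_not_parallel {U : Fin 2 → Set (Fin Nr → ℝ)} (hU : ∀ i, IsOpen (U i))
    (hpos : ∀ g ∈ Set.univ.pi U, ∀ i r, 0 < g i r) {r s : Fin Nr} (hrs : r ≠ s)
    {g : Gains Nr} (hg : g ∈ Set.univ.pi U) :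
    ∃ g' ∈ Set.univ.pi U, (∀ i, powerGain σ (g' i) = powerGain σ (g i)) ∧
      g' 0 r * g' 1 s ≠ g' 0 s * g' 1 r := by
  by_cases hpar : g 0 r * g 1 s = g 0 s * g 1 r
  swap
  · exact ⟨g, hg, fun _ => rfl, hpar⟩
  -- A little gain is moved from antenna `s` to antenna `r`; the total gain is kept and
  -- proportionality is broken.
  obtain ⟨t, ht, htU⟩ := exists_pos_smul_mem_of_isOpen (hU 1) (hg 1 (Set.mem_univ _))
    (Pi.single r 1 - Pi.single s 1)
  set x := g 1 + t • (Pi.single r 1 - Pi.single s 1 : Fin Nr → ℝ) with hx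
  have hmem : Function.update g 1 x ∈ Set.univ.pi U := by
    intro i _
    by_cases hi : i = 1
    · subst hi; simpa using htU
    · rw [Function.update_of_ne hi]; exact hg i (Set.mem_univ _)
  have hxpos : ∀ k, 0 < x k := fun k => by simpa using hpos _ hmem 1 k
  refine ⟨Function.update g 1 x, hmem, fun i => ?_, ?_⟩
  · by_cases hi : i = 1
    · subst hi
      rw [Function.update_self, powerGain_eq_of_nonneg fun k => (hxpos k).le,
        powerGain_eq_of_nonneg fun k => (hpos g hg 1 k).le]
      simp [hx, Finset.sum_add_distrib, ← Finset.mul_sum]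
    · rw [Function.update_of_ne hi]
  · have e1 : x r = g 1 r + t := by simp [hx, Pi.single_eq_of_ne hrs]
    have e2 : x s = g 1 s - t := by simp [hx, Pi.single_eq_of_ne hrs.symm]; ring
    rw [Function.update_self, Function.update_of_ne zero_ne_one, e1, e2]
    intro h
    have h1 := mul_pos ht (add_pos (hpos g hg 0 r) (hpos g hg 0 s))
    nlinarith

/-- The intermediate value step: two states in a connected product, at which the two normalised
gains compare in opposite ways, yield a state at which they coincide. -/
theorem exists_equal_gains {U : Fin 2 → Set (Fin Nr → ℝ)} (hU : ∀ i, IsPreconnected (U i))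
    {f₀ f₁ : (Fin Nr → ℝ) → ℝ} (hf₀ : Continuous f₀) (hf₁ : Continuous f₁) {c : ℝ}
    {g g' : Gains Nr} (hg : g ∈ Set.univ.pi U) (hg' : g' ∈ Set.univ.pi U)
    (h1 : c < f₀ (g 0)) (h2 : f₁ (g 1) < f₀ (g 0)) (h3 : c < f₁ (g' 1)) (h4 : f₀ (g' 0) < f₁ (g' 1)) :
    ∃ G ∈ Set.univ.pi U, f₀ (G 0) = f₁ (G 1) ∧ c < f₀ (G 0) := by
  have hmk : ∀ x ∈ U 0, ∀ y ∈ U 1, (![x, y] : Gains Nr) ∈ Set.univ.pi U := by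
    intro x hx y hy i _
    fin_cases i
    · exact hx
    · exact hy
  -- Only the vector of one user is moved, the one with the smaller value, towards the larger value,
  -- so the common value stays above `c`.
  rcases le_total (f₀ (g 0)) (f₁ (g' 1)) with h | h
  · obtain ⟨y, hy, hyf⟩ := (hU 1).intermediate_value (hg 1 (Set.mem_univ _))
      (hg' 1 (Set.mem_univ _)) hf₁.continuousOn ⟨h2.le, h⟩
    exact ⟨![g 0, y], hmk _ (hg 0 (Set.mem_univ _)) _ hy, hyf.symm, h1⟩
  · obtain ⟨x, hx, hxf⟩ := (hU 0).intermediate_value (hg' 0 (Set.mem_univ _))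
      (hg 0 (Set.mem_univ _)) hf₀.continuousOn ⟨h4.le, h⟩
    exact ⟨![x, g' 1], hmk _ hx _ (hg' 1 (Set.mem_univ _)), hxf, by
      change c < f₀ x; rw [hxf]; exact h3⟩

variable [IsProbabilityMeasure μ]

/-- Were the users never active together, a lone transmitter would have gain above its multiplier
and the larger normalised gain, and each user is active somewhere. The intermediate value step gives
equal normalised gains `t > 1`. There, for non-parallel vectors, the cross gain is below the product
of the gains, which violates the conditions for a lone transmitter as well as for silence; strict
inequalities persist on an open set of positive probability. -/
theorem not_ae_mul_eq_zero (hNr : 2 ≤ Nr) (hnonneg : ∀ᵐ g ∂μ, ∀ i r, 0 ≤ g i r)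
    (hσ : 0 < σ) (hPbar : ∀ i, 0 < Pbar i) (h : IsGainChannel μ σ)
    (hm : IsMaxPair μ (fun g => powerGain σ (g 0)) (fun g => powerGain σ (g 1)) (gramDet σ)
      (Pbar 0) (Pbar 1) (P 0) (P 1))
    (hsupp : HasConnectedProductSupport μ) : ¬ ∀ᵐ g ∂μ, P 0 g * P 1 g = 0 := by
  intro hzero
  obtain ⟨U, hU, hV, hVc⟩ := hsupp
  obtain ⟨l₀, hl₀, hkt₀, hne₀⟩ := hm.kuhnTucker h (hPbar 0)
  obtain ⟨l₁, hl₁, hkt₁, hne₁⟩ := hm.swap.kuhnTucker h.swap (hPbar 1)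
  have hVo : IsOpen (Set.univ.pi U) := isOpen_set_pi Set.finite_univ fun i _ => (hU i).1
  have hpos : ∀ g ∈ Set.univ.pi U, ∀ i r, 0 < g i r := fun g hg =>
    gains_pos_of_mem_support hVo hV hnonneg hg
  have hmem : ∀ᵐ g ∂μ, g ∈ Set.univ.pi U := by
    filter_upwards [measure_eq_zero_iff_ae_notMem.1 hVc] with g hg using not_not.1 hg
  have hfirst : ∀ᵐ g ∂μ, P 0 g ≠ 0 → l₀ < powerGain σ (g 0) ∧
      (powerGain σ (g 1) - l₁) * powerGain σ (g 0) ^ 2 ≤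
        crossGain σ g * (powerGain σ (g 0) - l₀) ∧
      l₀ * powerGain σ (g 1) < l₁ * powerGain σ (g 0) := by
    filter_upwards [hkt₀, hkt₁, hzero, h.ae_pos] with g h0 h1 hz ⟨ha, hb, hd, _⟩ hne
    have hp : 0 < P 0 g := lt_of_le_of_ne (hm.1.2.1 g) hne.symm
    have hq : P 1 g = 0 := (mul_eq_zero.1 hz).resolve_left hne
    rw [hq] at h0 h1
    have := kuhnTucker_single_user ha hd hp hl₀ (h0.2 hp) h1.1
    have e : powerGain σ (g 0) * powerGain σ (g 1) - gramDet σ g = crossGain σ g := by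
      unfold gramDet; ring
    rwa [e] at this
  have hsecond : ∀ᵐ g ∂μ, P 1 g ≠ 0 → l₁ < powerGain σ (g 1) ∧
      (powerGain σ (g 0) - l₀) * powerGain σ (g 1) ^ 2 ≤
        crossGain σ g * (powerGain σ (g 1) - l₁) ∧
      l₁ * powerGain σ (g 0) < l₀ * powerGain σ (g 1) := by
    filter_upwards [hkt₀, hkt₁, hzero, h.ae_pos] with g h0 h1 hz ⟨ha, hb, hd, _⟩ hne
    have hq : 0 < P 1 g := lt_of_le_of_ne (hm.2.1.2.1 g) hne.symm
    have hp : P 0 g = 0 := (mul_eq_zero.1 hz).resolve_right hne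
    rw [hp] at h0 h1
    have := kuhnTucker_single_user hb hd hq hl₁ (h1.2 hq) h0.1
    have e : powerGain σ (g 1) * powerGain σ (g 0) - gramDet σ g = crossGain σ g := by
      unfold gramDet; ring
    rwa [e] at this
  have hneither : ∀ᵐ g ∂μ, P 0 g = 0 → P 1 g = 0 → powerGain σ (g 0) ≤ l₀ := by
    filter_upwards [hkt₀] with g h0 hp hq
    rw [hp, hq] at h0
    simpa [marginal, rxDet] using h0.1
  obtain ⟨g, hg0, hgU, hgF⟩ :=
    ((Filter.not_eventually.1 hne₀).and_eventually (hmem.and hfirst)).exists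
  obtain ⟨g', hg0', hgU', hgF'⟩ :=
    ((Filter.not_eventually.1 hne₁).and_eventually (hmem.and hsecond)).exists
  obtain ⟨f1, _, f2⟩ := hgF hg0
  obtain ⟨f3, _, f4⟩ := hgF' hg0'
  have hc := continuous_powerGain (σ := σ) (Nr := Nr)
  obtain ⟨G, hG, hGeq, hG1⟩ := exists_equal_gains (fun i => (hU i).2.isPreconnected)
    (f₀ := fun x => powerGain σ x / l₀) (f₁ := fun x => powerGain σ x / l₁) (c := 1)
    (hc.div_const _) (hc.div_const _) hgU hgU'
    ((one_lt_div hl₀).2 f1) ((div_lt_div_iff₀ hl₁ hl₀).2 (by linarith))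
    ((one_lt_div hl₁).2 f3) ((div_lt_div_iff₀ hl₀ hl₁).2 (by linarith))
  obtain ⟨K, hK, hKG, hKpar⟩ := exists_not_parallel (σ := σ) (fun i => (hU i).1) hpos
    (show (⟨0, by omega⟩ : Fin Nr) ≠ ⟨1, by omega⟩ by simp) hG
  have hdet := gramDet_pos hσ (hpos K hK) hKpar
  rw [← hKG 0, ← hKG 1] at hGeq
  rw [← hKG 0] at hG1
  set t := powerGain σ (K 0) / l₀ with ht
  have e0 : powerGain σ (K 0) = l₀ * t := by rw [ht]; field_simp
  have e1 : powerGain σ (K 1) = l₁ * t := by rw [hGeq]; field_simp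
  set O : Set (Gains Nr) := Set.univ.pi U ∩ ({g | l₀ < powerGain σ (g 0)} ∩
    ({g | crossGain σ g * (powerGain σ (g 0) - l₀) <
        (powerGain σ (g 1) - l₁) * powerGain σ (g 0) ^ 2} ∩
      {g | crossGain σ g * (powerGain σ (g 1) - l₁) <
        (powerGain σ (g 0) - l₀) * powerGain σ (g 1) ^ 2})) with hO
  have hcx := continuous_crossGain (σ := σ) (Nr := Nr)
  have hOo : IsOpen O := hVo.inter ((isOpen_lt (by fun_prop) (by fun_prop)).inter
    ((isOpen_lt (by fun_prop) (by fun_prop)).inter (isOpen_lt (by fun_prop) (by fun_prop))))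
  have hKO : K ∈ O := by
    -- A positive Gram determinant puts the cross gain below the product of the gains; multiplied by
    -- `l₀ (t - 1)` or `l₁ (t - 1)`, this yields the two strict inequalities that define `O`.
    have hx : crossGain σ K < l₀ * t * (l₁ * t) := by
      unfold gramDet at hdet; rw [e0, e1] at hdet; linarith
    have ht1 : 0 < t - 1 := by linarith
    refine ⟨hK, ?_, ?_, ?_⟩
    · change l₀ < powerGain σ (K 0)
      rw [e0]; nlinarith
    · change crossGain σ K * (powerGain σ (K 0) - l₀) <
        (powerGain σ (K 1) - l₁) * powerGain σ (K 0) ^ 2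
      rw [e0, e1]
      have := mul_lt_mul_of_pos_right hx (mul_pos hl₀ ht1)
      calc _ = crossGain σ K * (l₀ * (t - 1)) := by ring
        _ < _ := this
        _ = _ := by ring
    · change crossGain σ K * (powerGain σ (K 1) - l₁) <
        (powerGain σ (K 0) - l₀) * powerGain σ (K 1) ^ 2
      rw [e0, e1]
      have := mul_lt_mul_of_pos_right hx (mul_pos hl₁ ht1)
      calc _ = crossGain σ K * (l₁ * (t - 1)) := by ring
        _ < _ := this
        _ = _ := by ring
  have hμO : μ O ≠ 0 := fun h0 =>
    (eq_empty_of_isOpen_null hV hOo Set.inter_subset_left h0 ▸ hKO : K ∈ (∅ : Set (Gains Nr)))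
  obtain ⟨z, ⟨_, hz1, hz2, hz3⟩, hzF, hzS, hzN⟩ := ((frequently_ae_mem_iff.2 hμO).and_eventually
    (hfirst.and (hsecond.and hneither))).exists
  by_cases hz0 : P 0 z = 0
  · by_cases hz0' : P 1 z = 0
    · exact absurd hz1 (not_lt.2 (hzN hz0 hz0'))
    · exact absurd hz3 (not_lt.2 (hzS hz0').2.1)
  · exact absurd hz2 (not_lt.2 (hzF hz0).2.1)

end Support

/-! ### Equilibria and maximum sum-rate points -/

section Equilibrium

variable {Nr : ℕ} {μ : Measure (Gains Nr)} {σ : ℝ} {Pbar : Fin 2 → ℝ}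
  {P Q : Fin 2 → Gains Nr → ℝ} {R : Fin 2 → ℝ}

/-- A feasible policy pair of maximal joint rate bound. -/
def IsOptimal (μ : Measure (Gains Nr)) (σ : ℝ) (Pbar : Fin 2 → ℝ) (P : Fin 2 → Gains Nr → ℝ) :
    Prop :=
  (∀ i, IsFeasible μ (Pbar i) (P i)) ∧ ∀ Q : Fin 2 → Gains Nr → ℝ,
    (∀ i, IsFeasible μ (Pbar i) (Q i)) → groupBound μ σ Finset.univ Q ≤ groupBound μ σ Finset.univ P

theorem groupBound_univ_le_iff (hσ : 0 < σ) :
    groupBound μ σ Finset.univ Q ≤ groupBound μ σ Finset.univ P ↔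
      gainSumRate μ σ Q ≤ gainSumRate μ σ P := by
  rw [groupBound_eq hσ, groupBound_eq hσ, restrictUsers_univ, restrictUsers_univ]
  exact mul_le_mul_iff_right₀ (by have := Real.log_pos (one_lt_two (α := ℝ)); positivity)

theorem isOptimal_iff_isMaxPair (hσ : 0 < σ) : IsOptimal μ σ Pbar P ↔
    IsMaxPair μ (fun g => powerGain σ (g 0)) (fun g => powerGain σ (g 1)) (gramDet σ)
      (Pbar 0) (Pbar 1) (P 0) (P 1) := by
  constructor
  · rintro ⟨hP, hmax⟩
    refine ⟨hP 0, hP 1, fun p q hp hq => ?_⟩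
    exact (groupBound_univ_le_iff hσ).1 (hmax ![p, q] (Fin.forall_fin_two.2 ⟨hp, hq⟩))
  · rintro ⟨h0, h1, hmax⟩
    exact ⟨Fin.forall_fin_two.2 ⟨h0, h1⟩, fun Q hQ =>
      (groupBound_univ_le_iff hσ).2 (hmax _ _ (hQ 0) (hQ 1))⟩

theorem isFeasible_update (hP : ∀ i, IsFeasible μ (Pbar i) (P i)) {i : Fin 2}
    {q : Gains Nr → ℝ} (hq : IsFeasible μ (Pbar i) q) (k : Fin 2) :
    IsFeasible μ (Pbar k) (Function.update P i q k) := by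
  by_cases hk : k = i
  · subst hk; simpa using hq
  · rw [Function.update_of_ne hk]; exact hP k

variable [IsProbabilityMeasure μ]

/-- A unilateral deviation compares payoffs and sum-rates in the same way, so an equilibrium is a
coordinatewise maximizer; by concavity it is a joint one. -/
theorem isNash_iff_isOptimal (h : IsGainChannel μ σ) (hσ : 0 < σ) (hPbar : ∀ i, 0 < Pbar i) :
    IsNash μ σ Pbar P ↔ IsOptimal μ σ Pbar P := by
  have hpay : (∀ i, IsFeasible μ (Pbar i) (P i)) → ∀ i q, IsFeasible μ (Pbar i) q →
      (payoff μ σ i (Function.update P i q) ≤ payoff μ σ i P ↔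
        gainSumRate μ σ (Function.update P i q) ≤ gainSumRate μ σ P) := by
    intro hP i q hq
    rw [payoff_eq h hσ hPbar hP, payoff_eq h hσ hPbar (isFeasible_update hP hq),
      groupBound_update_compl, sub_le_sub_iff_right, groupBound_univ_le_iff hσ]
  constructor
  · rintro ⟨hP, hN⟩
    refine (isOptimal_iff_isMaxPair hσ).2 (isMaxPair_of_coordinatewise h (hP 0) (hP 1)
      (fun p hp => ?_) fun q hq => ?_)
    · simpa [gainSumRate] using (hpay hP 0 p hp).1 (hN 0 p hp)
    · simpa [gainSumRate] using (hpay hP 1 q hq).1 (hN 1 q hq)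
  · rintro ⟨hP, hmax⟩
    exact ⟨hP, fun i q hq => (hpay hP i q hq).2
      ((groupBound_univ_le_iff hσ).1 (hmax _ (isFeasible_update hP hq)))⟩

theorem IsOptimal.ae_eq (h : IsGainChannel μ σ) (hσ : 0 < σ) (hP : IsOptimal μ σ Pbar P)
    (hQ : IsOptimal μ σ Pbar Q) (i : Fin 2) : Q i =ᵐ[μ] P i := by
  rw [isOptimal_iff_isMaxPair hσ] at hP hQ
  revert i
  exact Fin.forall_fin_two.2 ⟨hQ.ae_eq_left h hP, hQ.ae_eq_right h hP⟩

theorem groupBound_univ_le_add (h : IsGainChannel μ σ) (hσ : 0 < σ) (hPbar : ∀ i, 0 < Pbar i)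
    (hP : ∀ i, IsFeasible μ (Pbar i) (P i)) :
    groupBound μ σ Finset.univ P ≤ groupBound μ σ {0} P + groupBound μ σ {1} P := by
  rw [groupBound_eq hσ, groupBound_eq hσ, groupBound_eq hσ, restrictUsers_univ, ← mul_add]
  exact mul_le_mul_of_nonneg_left (gainSumRate_singleton_add h hPbar hP).1
    (by have := Real.log_pos (one_lt_two (α := ℝ)); positivity)

theorem finset_fin_two_cases (S : Finset (Fin 2)) :
    S = ∅ ∨ S = {0} ∨ S = {1} ∨ S = Finset.univ := by
  revert S; decide

/-- On the maximal-sum face nonnegativity is automatic: each rate is at least the total minus the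
bound of the other user, which is nonnegative by monotonicity. -/
theorem mem_rateRegion_iff (h : IsGainChannel μ σ) (hσ : 0 < σ) (hPbar : ∀ i, 0 < Pbar i)
    (hP : ∀ i, IsFeasible μ (Pbar i) (P i)) (hR : ∑ i, R i = groupBound μ σ Finset.univ P) :
    R ∈ rateRegion μ σ P ↔ R 0 ≤ groupBound μ σ {0} P ∧ R 1 ≤ groupBound μ σ {1} P := by
  constructor
  · rintro ⟨_, hS⟩
    exact ⟨by simpa using hS {0}, by simpa using hS {1}⟩
  · rintro ⟨h0, h1⟩
    have m0 := groupBound_mono h hσ hPbar hP (Finset.subset_univ {0})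
    have m1 := groupBound_mono h hσ hPbar hP (Finset.subset_univ {1})
    refine ⟨Fin.forall_fin_two.2 ⟨?_, ?_⟩, fun S => ?_⟩
    · rw [Fin.sum_univ_two] at hR; linarith
    · rw [Fin.sum_univ_two] at hR; linarith
    · rcases finset_fin_two_cases S with rfl | rfl | rfl | rfl
      · rw [groupBound_empty]; simp
      · simpa using h0
      · simpa using h1
      · exact hR.le

omit [IsProbabilityMeasure μ] in
theorem sum_le_of_mem_capacityRegion (hP : IsOptimal μ σ Pbar P)
    (hR : R ∈ capacityRegion μ σ Pbar) : ∑ i, R i ≤ groupBound μ σ Finset.univ P := by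
  obtain ⟨Q, hQ, hRQ⟩ := hR
  exact (hRQ.2 Finset.univ).trans (hP.2 Q hQ)

omit [IsProbabilityMeasure μ] in
theorem isSumRatePoint_of_mem (hP : IsOptimal μ σ Pbar P) (hR : R ∈ rateRegion μ σ P)
    (hsum : ∑ i, R i = groupBound μ σ Finset.univ P) : IsSumRatePoint μ σ Pbar R :=
  ⟨⟨P, hP.1, hR⟩, fun R' hR' => by rw [hsum]; exact sum_le_of_mem_capacityRegion hP hR'⟩

theorem exists_isSumRatePoint (h : IsGainChannel μ σ) (hσ : 0 < σ) (hPbar : ∀ i, 0 < Pbar i)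
    (hP : IsOptimal μ σ Pbar P) : ∃ R, R ∈ rateRegion μ σ P ∧ IsSumRatePoint μ σ Pbar R ∧
      ∑ i, R i = groupBound μ σ Finset.univ P := by
  -- The witness is a corner of the pentagon, with user `1` at its single-user bound.
  have hsum : ∑ i, (![groupBound μ σ Finset.univ P - groupBound μ σ {1} P,
      groupBound μ σ {1} P] : Fin 2 → ℝ) i = groupBound μ σ Finset.univ P := by
    simp [Fin.sum_univ_two]
  have hmem := (mem_rateRegion_iff h hσ hPbar hP.1 hsum).2 (by
    have := groupBound_univ_le_add h hσ hPbar hP.1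
    refine ⟨?_, ?_⟩
    · simp; linarith
    · simp)
  exact ⟨_, hmem, isSumRatePoint_of_mem hP hmem hsum, hsum⟩

theorem IsSumRatePoint.sum_eq (h : IsGainChannel μ σ) (hσ : 0 < σ) (hPbar : ∀ i, 0 < Pbar i)
    (hP : IsOptimal μ σ Pbar P) (hR : IsSumRatePoint μ σ Pbar R) :
    ∑ i, R i = groupBound μ σ Finset.univ P := by
  obtain ⟨R', _, hR', hsum⟩ := exists_isSumRatePoint h hσ hPbar hP
  exact le_antisymm (sum_le_of_mem_capacityRegion hP hR.1) (hsum ▸ hR.2 R' hR'.1)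

/-- Any feasible pair whose pentagon contains a maximum sum-rate point is optimal. -/
theorem IsSumRatePoint.isOptimal (h : IsGainChannel μ σ) (hσ : 0 < σ) (hPbar : ∀ i, 0 < Pbar i)
    (hP : IsOptimal μ σ Pbar P) (hR : IsSumRatePoint μ σ Pbar R)
    (hQ : ∀ i, IsFeasible μ (Pbar i) (Q i)) (hRQ : R ∈ rateRegion μ σ Q) :
    IsOptimal μ σ Pbar Q :=
  ⟨hQ, fun Q' hQ' => (hP.2 Q' hQ').trans ((hR.sum_eq h hσ hPbar hP) ▸ hRQ.2 Finset.univ)⟩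

/-- The point may come from the pentagon of another pair, but that pair is optimal, hence almost
surely equal to `P`, and has the same bounds. -/
theorem IsSumRatePoint.sum_le (h : IsGainChannel μ σ) (hσ : 0 < σ) (hPbar : ∀ i, 0 < Pbar i)
    (hP : IsOptimal μ σ Pbar P) (hR : IsSumRatePoint μ σ Pbar R) (S : Finset (Fin 2)) :
    ∑ i ∈ S, R i ≤ groupBound μ σ S P := by
  obtain ⟨Q, hQ, hRQ⟩ := hR.1
  have hQopt := hR.isOptimal h hσ hPbar hP hQ hRQ
  rw [← groupBound_congr_ae (hP.ae_eq h hσ hQopt)]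
  exact hRQ.2 S

theorem payoff_le_of_isSumRatePoint (h : IsGainChannel μ σ) (hσ : 0 < σ)
    (hPbar : ∀ i, 0 < Pbar i) (hP : IsOptimal μ σ Pbar P) (hR : IsSumRatePoint μ σ Pbar R)
    (i : Fin 2) : payoff μ σ i P ≤ R i := by
  rw [payoff_eq h hσ hPbar hP.1]
  have h1 := hR.sum_le h hσ hPbar hP {i}ᶜ
  have h2 := hR.sum_eq h hσ hPbar hP
  have h3 := Finset.sum_add_sum_compl {i} R
  rw [Finset.sum_singleton] at h3
  linarith

theorem groupBound_univ_lt_add (hNr : 2 ≤ Nr) (hdens : μ ≪ volume)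
    (hnonneg : ∀ᵐ g ∂μ, ∀ i r, 0 ≤ g i r) (h : IsGainChannel μ σ) (hσ : 0 < σ)
    (hPbar : ∀ i, 0 < Pbar i) (hP : IsOptimal μ σ Pbar P)
    (hsupp : HasConnectedProductSupport μ) :
    groupBound μ σ Finset.univ P < groupBound μ σ {0} P + groupBound μ σ {1} P := by
  refine lt_of_le_of_ne (groupBound_univ_le_add h hσ hPbar hP.1) fun heq => ?_
  rw [groupBound_eq hσ, groupBound_eq hσ, groupBound_eq hσ, restrictUsers_univ, ← mul_add] at heq
  have hz := (gainSumRate_singleton_add h hPbar hP.1).2 (mul_left_cancel₀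
    (by have := Real.log_pos (one_lt_two (α := ℝ)); positivity) heq)
  refine not_ae_mul_eq_zero hNr hnonneg hσ hPbar h ((isOptimal_iff_isMaxPair hσ).1 hP) hsupp ?_
  filter_upwards [hz, ae_gains_generic hdens hnonneg
    (show (⟨0, by omega⟩ : Fin Nr) ≠ ⟨1, by omega⟩ by simp)] with g hg hgen
  exact (mul_eq_zero.1 hg).resolve_left (crossGain_pos hσ hgen.1 ⟨0, by omega⟩).ne'

end Equilibrium

end VectorMAC

/-! ### The main theorem -/

theorem mainTheorem4 (Nr : ℕ) (hNr : 2 ≤ Nr)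
    (μ : MeasureTheory.Measure (VectorMAC.Gains Nr)) [MeasureTheory.IsProbabilityMeasure μ]
    (hdens : μ.AbsolutelyContinuous MeasureTheory.volume)
    (hnonneg : ∀ᵐ g ∂μ, ∀ i r, 0 ≤ g i r)
    (hlog : ∀ i, MeasureTheory.Integrable
      (fun g : VectorMAC.Gains Nr => Real.log (1 + ∑ r, g i r)) μ)
    (σ : ℝ) (hσ : 0 < σ) (Pbar : Fin 2 → ℝ) (hPbar : ∀ i, 0 < Pbar i) :
    ∃ P : Fin 2 → VectorMAC.Gains Nr → ℝ,
      -- existence and uniqueness of the Nash equilibrium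
      VectorMAC.IsNash μ σ Pbar P ∧
      (∀ Q, VectorMAC.IsNash μ σ Pbar Q → ∀ i, Q i =ᵐ[μ] P i) ∧
      -- its policies are the (unique) centralized sum-rate optimal ones
      VectorMAC.IsSumRatePolicy μ σ Pbar P ∧
      (∀ Q, VectorMAC.IsSumRatePolicy μ σ Pbar Q → ∀ i, Q i =ᵐ[μ] P i) ∧
      -- the equilibrium rates never exceed those at a maximum sum-rate point
      (∀ R, VectorMAC.IsSumRatePoint μ σ Pbar R → ∀ i, VectorMAC.payoff μ σ i P ≤ R i) ∧
      -- and they are strictly smaller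
      (VectorMAC.HasConnectedProductSupport μ →
        (∀ R, VectorMAC.IsSumRatePoint μ σ Pbar R → ∃ i, VectorMAC.payoff μ σ i P < R i) ∧
        (∃ R, VectorMAC.IsSumRatePoint μ σ Pbar R ∧ ∀ i, VectorMAC.payoff μ σ i P < R i)) := by
  have h := VectorMAC.isChannel_of_gains hNr hdens hnonneg hlog hσ
  obtain ⟨p, q, hpq⟩ := VectorMAC.exists_isMaxPair h (hPbar 0) (hPbar 1)
  have hP : VectorMAC.IsOptimal μ σ Pbar ![p, q] :=
    (VectorMAC.isOptimal_iff_isMaxPair hσ).2 hpq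
  generalize (![p, q] : Fin 2 → VectorMAC.Gains Nr → ℝ) = P at hP
  obtain ⟨R₀, hR₀, hR₀s, _⟩ := VectorMAC.exists_isSumRatePoint h hσ hPbar hP
  refine ⟨P, (VectorMAC.isNash_iff_isOptimal h hσ hPbar).2 hP,
    fun Q hQ => hP.ae_eq h hσ ((VectorMAC.isNash_iff_isOptimal h hσ hPbar).1 hQ),
    ⟨hP.1, R₀, hR₀s, hR₀⟩,
    fun Q ⟨hQ, R, hR, hRQ⟩ => hP.ae_eq h hσ (hR.isOptimal h hσ hPbar hP hQ hRQ),
    fun R hR => VectorMAC.payoff_le_of_isSumRatePoint h hσ hPbar hP hR, fun hsupp => ?_⟩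
  have hlt := VectorMAC.groupBound_univ_lt_add hNr hdens hnonneg h hσ hPbar hP hsupp
  have e0 : VectorMAC.payoff μ σ 0 P = VectorMAC.groupBound μ σ Finset.univ P -
      VectorMAC.groupBound μ σ {1} P := VectorMAC.payoff_eq h hσ hPbar hP.1 0
  have e1 : VectorMAC.payoff μ σ 1 P = VectorMAC.groupBound μ σ Finset.univ P -
      VectorMAC.groupBound μ σ {0} P := VectorMAC.payoff_eq h hσ hPbar hP.1 1
  -- If neither inequality were strict, the total would be at most twice itself minus the two
  -- single-user bounds, which is less than the total.
  constructor
  · intro R hR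
    by_contra! hcon
    have h2 := hR.sum_eq h hσ hPbar hP
    rw [Fin.sum_univ_two] at h2
    have h3 := hcon 0
    have h4 := hcon 1
    linarith
  -- The witness is the midpoint of the maximal-sum face, on which each rate ranges from the payoff
  -- to the single-user bound.
  · have hsum : ∑ i, (![(VectorMAC.payoff μ σ 0 P + VectorMAC.groupBound μ σ {0} P) / 2,
        (VectorMAC.payoff μ σ 1 P + VectorMAC.groupBound μ σ {1} P) / 2] : Fin 2 → ℝ) i =
        VectorMAC.groupBound μ σ Finset.univ P := by
      rw [Fin.sum_univ_two, e0, e1]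
      simp only [Matrix.cons_val_zero, Matrix.cons_val_one]
      ring
    refine ⟨_, VectorMAC.isSumRatePoint_of_mem hP
      ((VectorMAC.mem_rateRegion_iff h hσ hPbar hP.1 hsum).2 ⟨?_, ?_⟩) hsum,
      Fin.forall_fin_two.2 ⟨?_, ?_⟩⟩ <;>
    simp only [Matrix.cons_val_zero, Matrix.cons_val_one] <;> linarith
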